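/- **Definitions.** Let $G=G(A,B)$ be a bipartite graph with sides $A$ and $B$. For $X\subseteq A$ with $|X|\ge 2$ let $N^2_G(X)$ be the set of vertices of $G$ having at least two neighbours in $X$. $G$ is a *dHp graph* if $|A|\ge 2$ and $|N^2_G(X)|\ge |X|$ (as cardinals) for every $X\subseteq A$ with $|X|\ge 2$. *Salia's conjecture for finite graphs* is the assertion: for every finite bipartite graph $H$ with sides $A_0,B_0$ such that $|N^2_H(X)|\ge |X|$ for all $X\subseteq A_0$ with $|X|\ge 2$, and for every $X\subseteq A_0$ with $|X|\ge 2$, there is a cycle $C_X$ in $H$ with $V(C_X)\cap A_0=X$. A *ray* in $G$ is a one-way infinite path. Two rays are equivalent if for every finite $F\subseteq V(G)$ they have tails in the same component of $G\setminus F$; the equivalence classes are the *ends* of $G$, and $\Omega(G)$ is the set of ends. For a finite $F\subseteq V(G)$ and $\varepsilon\in\Omega(G)$, let $C(F,\varepsilon)$ be the unique component of $G\setminus F$ containing a tail of every ray in $\varepsilon$. Let $|G|=G\cup\Omega(G)$, where $G$ is viewed as a $1$-complex in which every edge is a copy of $[0,1]$, with the topology whose basic open sets are: open intervals inside edges; for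 each vertex, the open stars of radius $1/n$ ($n\ge1$) around it; and, for each end $\varepsilon$ and finite $F\subseteq V(G)$, the set $$\{\varepsilon'\in\Omega(G): C(F,\varepsilon')=C(F,\varepsilon)\}\ \cup\ C(F,\varepsilon)\ \cup\ E(F,\varepsilon),$$ where $E(F,\varepsilon)$ is the set of all inner points of edges between $F$ and $C(F,\varepsilon)$. A *circle* is a subset of $|G|$ that is homeomorphic (in the subspace topology) to the unit circle $\mathbb S^1$. A *cycle* in $G$ (finite or infinite) is a subgraph that consists, for some circle $C$, of all edges of $G$ having an inner point in $C$ together with their endvertices. **Theorem 3.6.** Let $G(A,B)$ be a countable bipartite dHp graph with infinite sides $A$ and $B$, such that for each $v\in B$ either $\deg(v)=2$ or $N(v)=A$. If Salia's conjecture is true for finite graphs, then there exists a (finite or infinite) cycle in $G$, in the above sense, that contains all the vertices of $A$. -/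

import Mathlib

namespace DHall

universe u

variable {V : Type u}

/-! ### Bipartite graphs and the double Hall property -/

/-- `G` is a bipartite graph with sides `A` and `B`: the vertex set is the disjoint union of `A`
and `B`, and every edge joins `A` to `B`. -/
def IsBipartition (G : SimpleGraph V) (A B : Set V) : Prop :=
  A ∪ B = Set.univ ∧ G.IsBipartiteWith A B

/-- `N²(X)`: the vertices having at least two neighbours in `X`. -/
def nbr2 (G : SimpleGraph V) (X : Set V) : Set V :=
  {v | (G.neighborSet v ∩ X).Nontrivial}

/-- `|N²(X)| ≥ |X|` (as cardinals) for every `X ⊆ A` with at least two elements. -/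
def DoubleHallCondition (G : SimpleGraph V) (A : Set V) : Prop :=
  ∀ X : Set V, X ⊆ A → X.Nontrivial → Cardinal.mk X ≤ Cardinal.mk (nbr2 G X)

/-- `G(A, B)` is a dHp graph. -/
def IsDHP (G : SimpleGraph V) (A B : Set V) : Prop :=
  IsBipartition G A B ∧ A.Nontrivial ∧ DoubleHallCondition G A

/-- Salia's conjecture for finite graphs. -/
def SaliaConjectureFinite : Prop :=
  ∀ (W : Type) [Finite W] (G : SimpleGraph W) (A B : Set W),
    IsBipartition G A B → DoubleHallCondition G A →
      ∀ X : Set W, X ⊆ A → X.Nontrivial →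
        ∃ (v : W) (c : G.Walk v v), c.IsCycle ∧ {w | w ∈ c.support} ∩ A = X

/-! ### Rays and ends -/

/-- A ray: a one-way infinite path. -/
structure Ray (G : SimpleGraph V) where
  /-- the sequence of vertices of the ray -/
  vert : ℕ → V
  inj : Function.Injective vert
  adj : ∀ n, G.Adj (vert n) (vert (n + 1))

/-- The ray `r` has a tail in the component `C` of `G ∖ F`. -/
def Ray.TailIn {G : SimpleGraph V} (r : Ray G) {F : Finset V}
    (C : G.ComponentCompl (F : Set V)) : Prop :=
  ∃ N, ∀ n, N ≤ n → r.vert n ∈ C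

theorem Ray.exists_tailIn {G : SimpleGraph V} (r : Ray G) (F : Finset V) :
    ∃ C : G.ComponentCompl (F : Set V), r.TailIn C := by
  have hfin : (r.vert ⁻¹' (F : Set V)).Finite := F.finite_toSet.preimage r.inj.injOn
  obtain ⟨N, hN⟩ := hfin.bddAbove
  have hout : ∀ n, N + 1 ≤ n → r.vert n ∉ (F : Set V) := by
    intro n hn hmem
    have : n ≤ N := hN hmem
    omega
  refine ⟨G.componentComplMk (hout (N + 1) le_rfl), N + 1, ?_⟩
  intro n hn
  induction n, hn using Nat.le_induction with
  | base => exact ⟨hout _ le_rfl, rfl⟩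
  | succ n hn ih =>
    exact SimpleGraph.ComponentCompl.mem_of_adj _ _ ih (hout _ (by omega)) (r.adj n)

theorem Ray.tailIn_unique {G : SimpleGraph V} (r : Ray G) {F : Finset V}
    {C D : G.ComponentCompl (F : Set V)} (hC : r.TailIn C) (hD : r.TailIn D) : C = D := by
  obtain ⟨N, hN⟩ := hC
  obtain ⟨M, hM⟩ := hD
  obtain ⟨_, h₁⟩ := hN (max N M) (le_max_left _ _)
  obtain ⟨_, h₂⟩ := hM (max N M) (le_max_right _ _)
  exact h₁.symm.trans h₂

/-- Two rays are equivalent if, for every finite set `F` of vertices, they have tails in the same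
component of `G ∖ F`. -/
def Ray.Equivalent {G : SimpleGraph V} (r s : Ray G) : Prop :=
  ∀ F : Finset V, ∃ C : G.ComponentCompl (F : Set V), r.TailIn C ∧ s.TailIn C

theorem Ray.equivalent_equivalence (G : SimpleGraph V) :
    Equivalence (Ray.Equivalent (G := G)) where
  refl r F := (r.exists_tailIn F).imp fun _ h => ⟨h, h⟩
  symm h F := (h F).imp fun _ h => ⟨h.2, h.1⟩
  trans := by
    intro r s t hrs hst F
    obtain ⟨C, hrC, hsC⟩ := hrs F
    obtain ⟨D, hsD, htD⟩ := hst F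
    obtain rfl := s.tailIn_unique hsC hsD
    exact ⟨C, hrC, htD⟩

/-- The setoid of equivalent rays. -/
def raySetoid (G : SimpleGraph V) : Setoid (Ray G) :=
  ⟨Ray.Equivalent, Ray.equivalent_equivalence G⟩

/-- The end space `Ω(G)`. -/
def EndSpace (G : SimpleGraph V) : Type u := Quotient (raySetoid G)

/-- The end of a ray. -/
def Ray.toEnd {G : SimpleGraph V} (r : Ray G) : EndSpace G := Quotient.mk (raySetoid G) r

theorem EndSpace.existsUnique_comp {G : SimpleGraph V} (ε : EndSpace G) (F : Finset V) :
    ∃! C : G.ComponentCompl (F : Set V), ∀ r : Ray G, r.toEnd = ε → r.TailIn C := by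
  obtain ⟨r, rfl⟩ := Quotient.exists_rep ε
  obtain ⟨C, hC⟩ := r.exists_tailIn F
  refine ⟨C, ?_, fun D hD => r.tailIn_unique (hD r rfl) hC⟩
  intro s hs
  have hsr : Ray.Equivalent s r := Quotient.exact (s := raySetoid G) hs
  obtain ⟨D, hsD, hrD⟩ := hsr F
  exact r.tailIn_unique hrD hC ▸ hsD

/-- `C(F, ε)`: the component of `G ∖ F` that contains a tail of every ray in `ε`. -/
noncomputable def EndSpace.comp {G : SimpleGraph V} (ε : EndSpace G) (F : Finset V) :
    G.ComponentCompl (F : Set V) :=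
  (ε.existsUnique_comp F).choose

theorem EndSpace.comp_spec {G : SimpleGraph V} (ε : EndSpace G) (F : Finset V)
    (r : Ray G) (hr : r.toEnd = ε) : r.TailIn (ε.comp F) :=
  (ε.existsUnique_comp F).choose_spec.1 r hr

/-! ### The space `|G|` -/

/-- The vertex `v` as a point of the 1-complex of a graph, realized in barycentric coordinates. -/
noncomputable def pointOf (v : V) : V →₀ ℝ := Finsupp.single v 1

/-- The inner points of the edge `uv`, which is realized as the segment from `u` to `v`; the
distance of such a point `x` from `u` along the edge is `1 - x u = x v`. -/
def innerPts (u v : V) : Set (V →₀ ℝ) := openSegment ℝ (pointOf u) (pointOf v)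

/-- The point set of the 1-complex `G`: all vertices and all inner points of edges. -/
def complexPts (G : SimpleGraph V) : Set (V →₀ ℝ) :=
  {x | (∃ v, x = pointOf v) ∨ ∃ u v, G.Adj u v ∧ x ∈ innerPts u v}

/-- The points of `|G| = G ∪ Ω(G)`. -/
inductive EndCompl (G : SimpleGraph V) : Type u
  | pt (x : V →₀ ℝ) (hx : x ∈ complexPts G) : EndCompl G
  | atEnd (ε : EndSpace G) : EndCompl G

/-- The subset of `|G|` consisting of the points of the 1-complex that lie in `S`. -/
def ptsIn (G : SimpleGraph V) (S : Set (V →₀ ℝ)) : Set (EndCompl G) :=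
  {p | ∃ (x : V →₀ ℝ) (hx : x ∈ complexPts G), p = EndCompl.pt x hx ∧ x ∈ S}

/-- The open star of radius `1 / n` around `v` (for `n ≥ 1`): the points of the 1-complex on `v` or
on an edge at `v` whose distance `1 - x v` from `v` is less than `1 / n`. -/
def openStar (G : SimpleGraph V) (v : V) (n : ℕ) : Set (EndCompl G) :=
  ptsIn G {x | 1 - x v < 1 / (n : ℝ)}

/-- An open interval inside the edge `uv`. -/
def openInterval (G : SimpleGraph V) (u v : V) (a b : ℝ) : Set (EndCompl G) :=
  ptsIn G {x | x ∈ innerPts u v ∧ a < x u ∧ x u < b}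

/-- The basic open neighbourhood `Ω(F, ε) ∪ C(F, ε) ∪ E(F, ε)` of the end `ε`. -/
def endNhd (G : SimpleGraph V) (F : Finset V) (ε : EndSpace G) : Set (EndCompl G) :=
  {p | ∃ ε' : EndSpace G, p = EndCompl.atEnd ε' ∧ ε'.comp F = ε.comp F} ∪
  ptsIn G {x | (∃ v ∈ ε.comp F, x = pointOf v) ∨
    ∃ u ∈ ε.comp F, ∃ v ∈ ε.comp F, G.Adj u v ∧ x ∈ innerPts u v} ∪
  ptsIn G {x | ∃ u ∈ F, ∃ v ∈ ε.comp F, G.Adj u v ∧ x ∈ innerPts u v}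

/-- The topology of `|G|`. -/
instance instTopologicalSpaceEndCompl (G : SimpleGraph V) : TopologicalSpace (EndCompl G) :=
  TopologicalSpace.generateFrom
    ({U | ∃ (v : V) (n : ℕ), 1 ≤ n ∧ U = openStar G v n} ∪
      {U | ∃ (u v : V) (a b : ℝ), G.Adj u v ∧ U = openInterval G u v a b} ∪
      {U | ∃ (F : Finset V) (ε : EndSpace G), U = endNhd G F ε})

/-! ### Circles and cycles -/

/-- A circle in `|G|`: a subset homeomorphic to the unit circle. -/
def IsCircle {G : SimpleGraph V} (C : Set (EndCompl G)) : Prop :=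
  Nonempty (C ≃ₜ Circle)

/-- `uv` is an edge of `G` with an inner point in `C`. -/
def EdgeMeets (G : SimpleGraph V) (C : Set (EndCompl G)) (u v : V) : Prop :=
  G.Adj u v ∧ ∃ p ∈ C, p ∈ ptsIn G (innerPts u v)

theorem EdgeMeets.symm {G : SimpleGraph V} {C : Set (EndCompl G)} {u v : V}
    (h : EdgeMeets G C u v) : EdgeMeets G C v u := by
  refine ⟨h.1.symm, ?_⟩
  have h2 := h.2
  rwa [innerPts, openSegment_symm] at h2

/-- The subgraph of `G` consisting of the edges with an inner point in `C` and their endvertices. -/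
def subgraphOf (G : SimpleGraph V) (C : Set (EndCompl G)) : G.Subgraph where
  verts := {u | ∃ v, EdgeMeets G C u v}
  Adj := EdgeMeets G C
  adj_sub h := h.1
  edge_vert h := ⟨_, h⟩
  symm := ⟨fun _ _ h => h.symm⟩

/-- A (finite or infinite) cycle in `G`: the subgraph defined by a circle in `|G|`. -/
def IsTopCycle {G : SimpleGraph V} (H : G.Subgraph) : Prop :=
  ∃ C : Set (EndCompl G), IsCircle C ∧ H = subgraphOf G C

end DHall

namespace DHall

open Set Filter Topology

universe u

variable {V : Type u}

/-! ### Barycentric coordinates on `|G|` -/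

/-! Call a vertex of `B` full if its neighbourhood is `A`, and call a set of vertices robust if
deleting finitely many vertices never separates those that remain. Two mechanisms carry the proof.

Absorption: in a countable graph, an infinite robust set can be swept by two disjoint rays with
prescribed first vertices (`IsRobust.exists_rays`). Both meet it infinitely often, so they have the
same end, and together with that end they form an arc. Hence a 2-path `a b a'` of a finite cycle
with `a`, `a'` in a robust set may be replaced by an arc that picks up all of that set not yet on
the cycle. Doing this for several robust sets at once yields a circle, provided finite separators
keep the new ends distinct (`exists_isTopCycle_of_cycle`).

Partition: Salia's conjecture supplies finite cycles with any prescribed finite trace on `A`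
(`SaliaConjectureFinite.exists_cycle`), so it remains to find the robust sets. If infinitely many
vertices are full, `A` itself is robust. Otherwise let two vertices of `A` be linked if they are the
two neighbours of a vertex of `B`. An independent set of this link graph has only full vertices in
its `N²`, so the double Hall condition bounds its size. Therefore some finite deletion leaves the
largest possible number of components, and then no component can be cut further by a finite set. The
deleted vertices and the finite components form a finite set `S`. A cycle whose trace is `S` plus
many vertices of each infinite component can leave a component only through a full vertex or into
`S`, so by pigeonhole it has two consecutive vertices of `A` inside each infinite component, and
absorption applies.

The space `|G|` need not be Hausdorff: a full vertex cannot be separated from any end. The circle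
that is built meets only finitely many edges at each vertex, which makes it Hausdorff
(`t2Space_of_locallyFinite`), so a continuous bijection from the unit circle onto it is a
homeomorphism. Topological questions are reduced to barycentric coordinates throughout. -/

theorem complexPts_cases {G : SimpleGraph V} {x : V →₀ ℝ} (hx : x ∈ complexPts G) :
    (∃ v, x = pointOf v) ∨ ∃ u v a b, G.Adj u v ∧ 0 < a ∧ 0 < b ∧ a + b = 1 ∧
      x = Finsupp.single u a + Finsupp.single v b := by
  rcases hx with h | ⟨u, v, huv, a, b, ha, hb, hab, rfl⟩
  · exact Or.inl h
  · exact Or.inr ⟨u, v, a, b, huv, ha, hb, hab, by simp [pointOf]⟩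

theorem complexPts_nonneg {G : SimpleGraph V} {x : V →₀ ℝ} (hx : x ∈ complexPts G) (v : V) :
    0 ≤ x v := by
  classical
  rcases complexPts_cases hx with ⟨w, rfl⟩ | ⟨u, w, a, b, -, ha, hb, -, rfl⟩
  · simp only [pointOf, Finsupp.single_apply]; split_ifs <;> norm_num
  · simp only [Finsupp.add_apply, Finsupp.single_apply]; split_ifs <;> linarith

theorem complexPts_add_le {G : SimpleGraph V} {x : V →₀ ℝ} (hx : x ∈ complexPts G) {u v : V}
    (huv : u ≠ v) : x u + x v ≤ 1 := by
  classical
  rcases complexPts_cases hx with ⟨w, rfl⟩ | ⟨y, w, a, b, hyw, ha, hb, hab, rfl⟩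
  · simp only [pointOf, Finsupp.single_apply]
    split_ifs with h₁ h₂
    · exact absurd (h₁.symm.trans h₂) huv
    all_goals norm_num
  · simp only [Finsupp.add_apply, Finsupp.single_apply]
    split_ifs <;> first | (simp_all; done) | linarith

theorem complexPts_exists_pos {G : SimpleGraph V} {x : V →₀ ℝ} (hx : x ∈ complexPts G) :
    ∃ v, 0 < x v := by
  classical
  rcases complexPts_cases hx with ⟨w, rfl⟩ | ⟨y, w, a, b, hyw, ha, hb, hab, rfl⟩
  · exact ⟨w, by simp [pointOf]⟩
  · exact ⟨y, by simp [hyw.ne', ha]⟩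

theorem pos_of_mem_innerPts {x : V →₀ ℝ} {u v : V} (h : x ∈ innerPts u v) : 0 < x u ∧ 0 < x v := by
  classical
  obtain ⟨a, b, ha, hb, hab, rfl⟩ := h
  simp only [pointOf, Finsupp.add_apply, Finsupp.smul_apply, Finsupp.single_apply, smul_eq_mul]
  constructor <;> split_ifs <;> simp_all

theorem eq_zero_of_mem_innerPts {x : V →₀ ℝ} {u v w : V} (h : x ∈ innerPts u v) (hu : w ≠ u)
    (hv : w ≠ v) : x w = 0 := by
  classical
  obtain ⟨a, b, ha, hb, hab, rfl⟩ := h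
  simp [pointOf, hu.symm, hv.symm]

theorem add_eq_one_of_mem_innerPts {x : V →₀ ℝ} {u v : V} (h : x ∈ innerPts u v) (huv : u ≠ v) :
    x u + x v = 1 := by
  classical
  obtain ⟨a, b, ha, hb, hab, rfl⟩ := h
  simp [pointOf, huv, huv.symm, hab]

theorem eq_or_eq_of_mem_innerPts {x : V →₀ ℝ} {u v w : V} (h : x ∈ innerPts u v) (hw : 0 < x w) :
    w = u ∨ w = v := by
  by_contra hne
  push Not at hne
  exact hw.ne' (eq_zero_of_mem_innerPts h hne.1 hne.2)

theorem pointOf_pos_iff {v w : V} : 0 < pointOf v w ↔ w = v := by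
  classical
  simp only [pointOf, Finsupp.single_apply]
  split_ifs with h
  · simp [h]
  · simp [Ne.symm h]

/-- The support of a point is a vertex or the two ends of its edge. Thus the signs of the
coordinates locate a point, and membership in basic open sets becomes a condition on coordinates. -/
theorem mem_innerPts_of_pos {G : SimpleGraph V} {x : V →₀ ℝ} (hx : x ∈ complexPts G) {u v : V}
    (huv : u ≠ v) (hu : 0 < x u) (hv : 0 < x v) : G.Adj u v ∧ x ∈ innerPts u v := by
  rcases hx with ⟨w, rfl⟩ | ⟨y, w, hyw, h⟩
  · exact absurd ((pointOf_pos_iff.1 hu).trans (pointOf_pos_iff.1 hv).symm) huv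
  · rcases eq_or_eq_of_mem_innerPts h hu with rfl | rfl <;>
      rcases eq_or_eq_of_mem_innerPts h hv with rfl | rfl
    · exact absurd rfl huv
    · exact ⟨hyw, h⟩
    · exact ⟨hyw.symm, by rwa [innerPts, openSegment_symm]⟩
    · exact absurd rfl huv

theorem eq_pointOf_of_forall_pos {G : SimpleGraph V} {x : V →₀ ℝ} (hx : x ∈ complexPts G) {v : V}
    (h : ∀ w, 0 < x w → w = v) : x = pointOf v := by
  rcases hx with ⟨w, rfl⟩ | ⟨y, w, hyw, hx⟩
  · rw [h w (pointOf_pos_iff.2 rfl)]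
  · exact absurd ((h y (pos_of_mem_innerPts hx).1).trans (h w (pos_of_mem_innerPts hx).2).symm)
      hyw.ne

/-- The coordinate of a point of `|G|` at the vertex `v`; it vanishes at every end. -/
def EndCompl.coord {G : SimpleGraph V} (v : V) : EndCompl G → ℝ
  | .pt x _ => x v
  | .atEnd _ => 0

theorem mem_ptsIn_pt {G : SimpleGraph V} {S : Set (V →₀ ℝ)} {x : V →₀ ℝ} {hx : x ∈ complexPts G} :
    EndCompl.pt x hx ∈ ptsIn G S ↔ x ∈ S := by
  constructor
  · rintro ⟨y, hy, h, hS⟩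
    cases h
    exact hS
  · exact fun h => ⟨x, hx, rfl, h⟩

theorem atEnd_notMem_ptsIn {G : SimpleGraph V} {S : Set (V →₀ ℝ)} {ε : EndSpace G} :
    EndCompl.atEnd ε ∉ ptsIn G S := by
  rintro ⟨y, hy, h, -⟩
  cases h

theorem mem_openStar_iff {G : SimpleGraph V} {v : V} {n : ℕ} (hn : 1 ≤ n) {p : EndCompl G} :
    p ∈ openStar G v n ↔ 1 - p.coord v < 1 / (n : ℝ) := by
  cases p with
  | pt x hx => exact mem_ptsIn_pt
  | atEnd ε =>
    refine iff_of_false atEnd_notMem_ptsIn ?_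
    have : (1 : ℝ) ≤ n := by exact_mod_cast hn
    simp only [EndCompl.coord, sub_zero, not_lt]
    rw [div_le_one (by linarith)]
    exact this

theorem mem_openInterval_iff {G : SimpleGraph V} {u v : V} {a b : ℝ} (huv : G.Adj u v)
    {p : EndCompl G} :
    p ∈ openInterval G u v a b ↔
      0 < p.coord u ∧ 0 < p.coord v ∧ a < p.coord u ∧ p.coord u < b := by
  cases p with
  | pt x hx =>
    refine mem_ptsIn_pt.trans ⟨fun h => ⟨(pos_of_mem_innerPts h.1).1, (pos_of_mem_innerPts h.1).2,
      h.2⟩, fun h => ⟨(mem_innerPts_of_pos hx huv.ne h.1 h.2.1).2, h.2.2⟩⟩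
  | atEnd ε =>
    exact iff_of_false atEnd_notMem_ptsIn fun h => lt_irrefl _ h.1

/-- The vertex, inner-edge and boundary-edge clauses collapse into one open condition: a second
vertex in the support lies either in `F` or, being adjacent to `v`, in the same component as `v`. -/
theorem pt_mem_endNhd_iff {G : SimpleGraph V} {F : Finset V} {ε : EndSpace G} {x : V →₀ ℝ}
    {hx : x ∈ complexPts G} :
    EndCompl.pt x hx ∈ endNhd G F ε ↔ ∃ v ∈ ε.comp F, 0 < x v := by
  constructor
  · rintro ((⟨ε', h, -⟩ | h) | h)
    · cases h
    · rcases mem_ptsIn_pt.1 h with ⟨v, hv, rfl⟩ | ⟨u, hu, v, hv, huv, h⟩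
      · exact ⟨v, hv, pointOf_pos_iff.2 rfl⟩
      · exact ⟨u, hu, (pos_of_mem_innerPts h).1⟩
    · obtain ⟨u, hu, v, hv, huv, h⟩ := mem_ptsIn_pt.1 h
      exact ⟨v, hv, (pos_of_mem_innerPts h).2⟩
  · rintro ⟨v, hv, hpos⟩
    by_cases hex : ∃ w, w ≠ v ∧ 0 < x w
    · obtain ⟨w, hwv, hw⟩ := hex
      obtain ⟨hadj, hin⟩ := mem_innerPts_of_pos hx hwv hw hpos
      by_cases hF : w ∈ F
      · exact Or.inr (mem_ptsIn_pt.2 ⟨w, hF, v, hv, hadj, hin⟩)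
      · exact Or.inl (Or.inr (mem_ptsIn_pt.2 (Or.inr ⟨w,
          SimpleGraph.ComponentCompl.mem_of_adj _ _ hv (by simpa using hF) hadj.symm, v, hv, hadj, hin⟩)))
    · refine Or.inl (Or.inr (mem_ptsIn_pt.2 (Or.inl ⟨v, hv, ?_⟩)))
      refine eq_pointOf_of_forall_pos hx fun w hw => ?_
      by_contra hne
      exact hex ⟨w, hne, hw⟩

theorem atEnd_mem_endNhd_iff {G : SimpleGraph V} {F : Finset V} {ε ε' : EndSpace G} :
    EndCompl.atEnd ε' ∈ endNhd G F ε ↔ ε'.comp F = ε.comp F := by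
  constructor
  · rintro ((⟨ε'', h, h'⟩ | h) | h)
    · cases h; exact h'
    · exact absurd h atEnd_notMem_ptsIn
    · exact absurd h atEnd_notMem_ptsIn
  · exact fun h => Or.inl (Or.inl ⟨ε', rfl, h⟩)

theorem mem_endNhd_of_coord_pos {G : SimpleGraph V} {F : Finset V} {ε : EndSpace G}
    {p : EndCompl G} {v : V} (hv : v ∈ ε.comp F) (hp : 0 < p.coord v) : p ∈ endNhd G F ε := by
  cases p with
  | pt x hx => exact pt_mem_endNhd_iff.2 ⟨v, hv, hp⟩
  | atEnd ε => exact absurd hp (lt_irrefl _)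

theorem isOpen_openStar (G : SimpleGraph V) (v : V) {n : ℕ} (hn : 1 ≤ n) :
    IsOpen (openStar G v n) :=
  TopologicalSpace.isOpen_generateFrom_of_mem (Or.inl (Or.inl ⟨v, n, hn, rfl⟩))

theorem isOpen_openInterval {G : SimpleGraph V} {u v : V} (h : G.Adj u v) (a b : ℝ) :
    IsOpen (openInterval G u v a b) :=
  TopologicalSpace.isOpen_generateFrom_of_mem (Or.inl (Or.inr ⟨u, v, a, b, h, rfl⟩))

theorem isOpen_endNhd (G : SimpleGraph V) (F : Finset V) (ε : EndSpace G) :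
    IsOpen (endNhd G F ε) :=
  TopologicalSpace.isOpen_generateFrom_of_mem (Or.inr ⟨F, ε, rfl⟩)

/-- A map into `|G|` with continuous coordinates is continuous wherever its value is not an end. -/
theorem continuousAt_of_coord {Y : Type*} [TopologicalSpace Y] {G : SimpleGraph V}
    {f : Y → EndCompl G} {y : Y} {x : V →₀ ℝ} {hx : x ∈ complexPts G} (hy : f y = .pt x hx)
    (hf : ∀ v, ContinuousAt (fun z => (f z).coord v) y) : ContinuousAt f y := by
  refine TopologicalSpace.tendsto_nhds_generateFrom_iff.2 ?_
  rintro U ((⟨v, n, hn, rfl⟩ | ⟨u, v, a, b, huv, rfl⟩) | ⟨F, ε, rfl⟩) hU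
  · rw [mem_openStar_iff hn] at hU
    have := ((continuousAt_const (y := (1 : ℝ))).sub (hf v)).eventually_lt_const hU
    filter_upwards [this] with z hz
    exact (mem_openStar_iff hn).2 hz
  · rw [mem_openInterval_iff huv] at hU
    filter_upwards [(hf u).eventually_const_lt hU.1, (hf v).eventually_const_lt hU.2.1,
      (hf u).eventually_const_lt hU.2.2.1, (hf u).eventually_lt_const hU.2.2.2] with z h1 h2 h3 h4
    exact (mem_openInterval_iff huv).2 ⟨h1, h2, h3, h4⟩
  · rw [hy, pt_mem_endNhd_iff] at hU
    obtain ⟨v, hv, hpos⟩ := hU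
    have h0 : 0 < (f y).coord v := by rw [hy]; exact hpos
    filter_upwards [(hf v).eventually_const_lt h0] with z hz
    exact mem_endNhd_of_coord_pos hv hz

/-- Stars and intervals contain no ends, and a set `endNhd G F ε'` containing `ε` equals `endNhd G F
ε`, so only neighbourhoods named by `ε` itself need testing. -/
theorem continuousAt_of_endNhd {Y : Type*} [TopologicalSpace Y] {G : SimpleGraph V}
    {f : Y → EndCompl G} {y : Y} {ε : EndSpace G} (hy : f y = .atEnd ε)
    (hf : ∀ F, ∀ᶠ z in 𝓝 y, f z ∈ endNhd G F ε) : ContinuousAt f y := by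
  refine TopologicalSpace.tendsto_nhds_generateFrom_iff.2 ?_
  rintro U ((⟨v, n, hn, rfl⟩ | ⟨u, v, a, b, huv, rfl⟩) | ⟨F, ε', rfl⟩) hU
  · rw [hy] at hU
    exact absurd hU atEnd_notMem_ptsIn
  · rw [hy] at hU
    exact absurd hU atEnd_notMem_ptsIn
  · rw [hy, atEnd_mem_endNhd_iff] at hU
    filter_upwards [hf F] with z hz
    unfold endNhd at hz ⊢
    rwa [← hU]

/-- The coordinates are continuous away from the ends. -/
theorem continuousAt_coord_pt {G : SimpleGraph V} (v : V) {x : V →₀ ℝ} (hx : x ∈ complexPts G) :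
    ContinuousAt (EndCompl.coord v) (EndCompl.pt x hx) := by
  rw [Metric.continuousAt_iff']
  intro δ hδ
  rcases id hx with ⟨w, rfl⟩ | ⟨u, w, huw, h⟩
  · obtain ⟨n, hn⟩ := exists_nat_one_div_lt hδ
    have hmem : EndCompl.pt (pointOf w) hx ∈ openStar G w (n + 1) := by
      rw [mem_openStar_iff (by omega)]
      simp only [EndCompl.coord, pointOf, Finsupp.single_eq_same, sub_self]
      positivity
    filter_upwards [(isOpen_openStar G w (by omega)).mem_nhds hmem] with p hp
    rw [mem_openStar_iff (by omega)] at hp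
    cases p with
    | atEnd ε =>
      simp only [EndCompl.coord, sub_zero] at hp
      have : 1 / ((n + 1 : ℕ) : ℝ) ≤ 1 := by
        rw [div_le_one (by positivity)]; push_cast; linarith [n.cast_nonneg (α := ℝ)]
      linarith
    | pt y hy =>
      simp only [EndCompl.coord, Real.dist_eq] at hp ⊢
      push_cast at hp
      by_cases hvw : v = w
      · subst hvw
        have h1 : y v ≤ 1 := by
          -- The bound by 1 comes from the sum with another coordinate, so a graph with `v` as its
          -- only vertex is treated apart.
          by_cases hex : ∃ z, z ≠ v
          · obtain ⟨z, hz⟩ := hex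
            linarith [complexPts_add_le hy hz, complexPts_nonneg hy z]
          · rcases hy with ⟨z, rfl⟩ | ⟨z, z', hz, -⟩
            · simp only [pointOf]; classical
              rw [Finsupp.single_apply]; split_ifs <;> norm_num
            · exact absurd ((not_not.1 (not_exists.1 hex z)).trans
                (not_not.1 (not_exists.1 hex z')).symm) hz.ne
        simp only [pointOf, Finsupp.single_eq_same]
        rw [abs_lt]; constructor <;> linarith
      · have h0 : pointOf w v = 0 := by
          classical
          simp [pointOf, Ne.symm hvw]
        have := complexPts_add_le hy hvw
        have := complexPts_nonneg hy v
        rw [h0, abs_lt]; constructor <;> linarith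
  · have hmem : EndCompl.pt x hx ∈ openInterval G u w (x u - δ) (x u + δ) := by
      rw [mem_openInterval_iff huw]
      have := pos_of_mem_innerPts h
      exact ⟨this.1, this.2, by simp [EndCompl.coord, hδ], by simp [EndCompl.coord, hδ]⟩
    filter_upwards [(isOpen_openInterval huw _ _).mem_nhds hmem] with p hp
    cases p with
    | atEnd ε => exact absurd hp atEnd_notMem_ptsIn
    | pt y hy =>
      obtain ⟨hin, h1, h2⟩ := mem_ptsIn_pt.1 hp
      have e1 := add_eq_one_of_mem_innerPts h huw.ne
      have e2 := add_eq_one_of_mem_innerPts hin huw.ne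
      simp only [EndCompl.coord, Real.dist_eq, abs_lt]
      by_cases hvu : v = u
      · subst hvu; constructor <;> linarith
      by_cases hvw : v = w
      · subst hvw; constructor <;> linarith
      rw [eq_zero_of_mem_innerPts h hvu hvw, eq_zero_of_mem_innerPts hin hvu hvw]
      constructor <;> linarith

theorem EndCompl.pt_ext {G : SimpleGraph V} {x y : V →₀ ℝ} {hx : x ∈ complexPts G}
    {hy : y ∈ complexPts G} (h : ∀ v, x v = y v) : EndCompl.pt x hx = EndCompl.pt y hy := by
  obtain rfl : x = y := Finsupp.ext h
  rfl

theorem EndSpace.exists_comp_ne {G : SimpleGraph V} {ε ε' : EndSpace G} (h : ε ≠ ε') :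
    ∃ F, ε.comp F ≠ ε'.comp F := by
  by_contra hcon
  push Not at hcon
  apply h
  obtain ⟨r, rfl⟩ := Quotient.exists_rep ε
  obtain ⟨s, rfl⟩ := Quotient.exists_rep ε'
  refine Quotient.sound (s := raySetoid G) fun F => ⟨_, EndSpace.comp_spec _ F r rfl, ?_⟩
  change s.TailIn (EndSpace.comp ⟦r⟧ F)
  rw [hcon F]
  exact EndSpace.comp_spec _ F s rfl

theorem disjoint_endNhd {G : SimpleGraph V} {F : Finset V} {ε ε' : EndSpace G}
    (h : ε.comp F ≠ ε'.comp F) : Disjoint (endNhd G F ε) (endNhd G F ε') := by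
  rw [Set.disjoint_left]
  intro p hp hp'
  cases p with
  | atEnd ε'' => exact h ((atEnd_mem_endNhd_iff.1 hp).symm.trans (atEnd_mem_endNhd_iff.1 hp'))
  | pt x hx =>
    obtain ⟨v, hv, hxv⟩ := pt_mem_endNhd_iff.1 hp
    obtain ⟨w, hw, hxw⟩ := pt_mem_endNhd_iff.1 hp'
    by_cases hvw : v = w
    · subst hvw
      obtain ⟨_, h₁⟩ := hv
      obtain ⟨_, h₂⟩ := hw
      exact h (h₁.symm.trans h₂)
    · have hadj := (mem_innerPts_of_pos hx hvw hxv hxw).1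
      have : w ∈ ε.comp F :=
        SimpleGraph.ComponentCompl.mem_of_adj _ _ hv hw.1 hadj
      obtain ⟨_, h₁⟩ := this
      obtain ⟨_, h₂⟩ := hw
      exact h (h₁.symm.trans h₂)

/-- A subspace of `|G|` is Hausdorff if it meets only finitely many edges at each vertex. -/
theorem t2Space_of_locallyFinite {G : SimpleGraph V} {C : Set (EndCompl G)}
    (hC : ∀ v, {w | EdgeMeets G C v w}.Finite) : T2Space C := by
  classical
  have hcoord : ∀ v, Continuous fun p : C => p.1.coord v := by
    intro v
    rw [continuous_iff_continuousAt]
    rintro ⟨p, hp⟩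
    cases p with
    | pt x hx =>
      exact ContinuousAt.comp (g := EndCompl.coord v) (f := fun q : C => q.1)
        (x := ⟨_, hp⟩) (continuousAt_coord_pt v hx) continuousAt_subtype_val
    | atEnd ε =>
      refine (continuousAt_const (y := (0 : ℝ))).congr ?_
      -- With `v` and all its neighbours along edges of `C` in `F`, a point of `C` near `ε` lies on
      -- no edge at `v`, so its coordinate at `v` is 0.
      let F : Finset V := insert v (hC v).toFinset
      have hmem : EndCompl.atEnd ε ∈ endNhd G F ε := atEnd_mem_endNhd_iff.2 rfl
      have := continuousAt_subtype_val.preimage_mem_nhds (x := (⟨_, hp⟩ : C))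
        ((isOpen_endNhd G F ε).mem_nhds hmem)
      filter_upwards [this] with ⟨q, hq⟩ hqF
      cases q with
      | atEnd ε' => rfl
      | pt y hy =>
        by_contra hne
        have hyv : 0 < y v := lt_of_le_of_ne (complexPts_nonneg hy v) hne
        obtain ⟨w, hw, hyw⟩ := pt_mem_endNhd_iff.1 hqF
        have hwF : w ∉ F := by simpa using hw.1
        have hvw : v ≠ w := by rintro rfl; exact hwF (Finset.mem_insert_self _ _)
        obtain ⟨hadj, hin⟩ := mem_innerPts_of_pos hy hvw hyv hyw
        exact hwF (Finset.mem_insert_of_mem ((hC v).mem_toFinset.2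
          ⟨hadj, _, hq, mem_ptsIn_pt.2 hin⟩))
  refine ⟨fun p q hpq => ?_⟩
  -- Coordinates determine every point that is not an end, and some coordinate of such a point is
  -- positive; only pairs of ends escape them.
  by_cases hex : ∃ v, p.1.coord v ≠ q.1.coord v
  · obtain ⟨v, hv⟩ := hex
    exact separated_by_continuous (hcoord v) hv
  push Not at hex
  obtain ⟨p, hp⟩ := p
  obtain ⟨q, hq⟩ := q
  cases p with
  | pt x hx =>
    cases q with
    | pt y hy => exact absurd (Subtype.ext (EndCompl.pt_ext hex)) hpq
    | atEnd ε =>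
      obtain ⟨v, hv⟩ := complexPts_exists_pos hx
      exact absurd (hex v) hv.ne'
  | atEnd ε =>
    cases q with
    | pt y hy =>
      obtain ⟨v, hv⟩ := complexPts_exists_pos hy
      exact absurd (hex v) hv.ne
    | atEnd ε' =>
      have hne : ε ≠ ε' := by rintro rfl; exact hpq rfl
      obtain ⟨F, hF⟩ := EndSpace.exists_comp_ne hne
      exact ⟨_, _, (isOpen_endNhd G F ε).preimage continuous_subtype_val,
        (isOpen_endNhd G F ε').preimage continuous_subtype_val,
        atEnd_mem_endNhd_iff.2 rfl, atEnd_mem_endNhd_iff.2 rfl,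
        (disjoint_endNhd hF).preimage _⟩

/-! ### Arcs -/

/-- `S` is an arc from `p` to `q`. -/
def IsArc {X : Type*} [TopologicalSpace X] (S : Set X) (p q : X) : Prop :=
  ∃ γ : Path p q, Function.Injective γ ∧ range γ = S

section Arc

variable {X : Type*} [TopologicalSpace X] {p q r : X} {S T : Set X}

theorem IsArc.symm (h : IsArc S p q) : IsArc S q p := by
  obtain ⟨γ, hγ, rfl⟩ := h
  refine ⟨γ.symm, ?_, Path.symm_range γ⟩
  intro s t hst
  exact unitInterval.symm_bijective.injective (hγ hst)

theorem IsArc.left_mem (h : IsArc S p q) : p ∈ S := by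
  obtain ⟨γ, hγ, rfl⟩ := h
  exact ⟨0, γ.source⟩

theorem IsArc.right_mem (h : IsArc S p q) : q ∈ S := by
  obtain ⟨γ, hγ, rfl⟩ := h
  exact ⟨1, γ.target⟩

/-- A coincidence needs `s` in the first half and `t` strictly in the second, so the common value
lies on both paths and is not the junction `q`. The clause about `r` is kept for closed curves,
where the only permitted coincidence is at time 1. -/
theorem trans_eq_trans_cases {γ : Path p q} {δ : Path q r} (hγ : Function.Injective γ)
    (hδ : Function.Injective δ) {s t : unitInterval} (h : (γ.trans δ) s = (γ.trans δ) t)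
    (hst : s ≤ t) : s = t ∨
      (γ.trans δ) t ∈ range γ ∩ range δ ∧ (γ.trans δ) t ≠ q ∧ ((γ.trans δ) t = r → t = 1) := by
  have hst' : (s : ℝ) ≤ t := hst
  rw [Path.trans_apply, Path.trans_apply] at h
  split_ifs at h with h₁ h₂ h₂
  · left
    have := congrArg Subtype.val (hγ h)
    exact Subtype.ext (by simpa using this)
  · right
    rw [Path.trans_apply, dif_neg h₂]
    refine ⟨⟨⟨_, h⟩, ⟨_, rfl⟩⟩, fun hq => ?_, fun hr => ?_⟩
    · have := congrArg Subtype.val (hδ (hq.trans δ.source.symm))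
      simp only [Icc.coe_zero] at this
      exact h₂ (by linarith)
    · have := congrArg Subtype.val (hδ (hr.trans δ.target.symm))
      simp only [Icc.coe_one] at this
      exact Subtype.ext (by simp only [Icc.coe_one]; linarith)
  · exact absurd (hst'.trans h₂) h₁
  · left
    have := congrArg Subtype.val (hδ h)
    exact Subtype.ext (by simpa using this)

theorem IsArc.trans (hS : IsArc S p q) (hT : IsArc T q r) (hST : S ∩ T ⊆ {q}) :
    IsArc (S ∪ T) p r := by
  obtain ⟨γ, hγ, rfl⟩ := hS
  obtain ⟨δ, hδ, rfl⟩ := hT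
  refine ⟨γ.trans δ, ?_, Path.trans_range γ δ⟩
  have key : ∀ s t, s ≤ t → (γ.trans δ) s = (γ.trans δ) t → s = t := fun s t hst h =>
    (trans_eq_trans_cases hγ hδ h hst).resolve_right fun h' => h'.2.1 (hST h'.1)
  intro s t h
  rcases le_total s t with hst | hst
  · exact key s t hst h
  · exact (key t s hst h.symm).symm

/-- Two arcs with the same ends that are otherwise disjoint form a circle. -/
theorem IsArc.nonempty_homeomorph_circle (hS : IsArc S p q) (hT : IsArc T q p)
    (hST : S ∩ T ⊆ {p, q}) [T2Space ↥(S ∪ T)] : Nonempty (↥(S ∪ T) ≃ₜ Circle) := by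
  obtain ⟨γ, hγ, rfl⟩ := hS
  obtain ⟨δ, hδ, rfl⟩ := hT
  have hrange : range (γ.trans δ) = range γ ∪ range δ := Path.trans_range γ δ
  have key : ∀ s t, s ≤ t → t ≠ 1 → (γ.trans δ) s = (γ.trans δ) t → s = t := by
    intro s t hst ht h
    refine (trans_eq_trans_cases hγ hδ h hst).resolve_right fun h' => ?_
    rcases hST h'.1 with hp | hq
    · exact ht (h'.2.2 hp)
    · exact h'.2.1 hq
  have hmem : ∀ t, (γ.trans δ).extend t ∈ range γ ∪ range δ := by
    intro t
    rw [← hrange, ← Path.extend_range]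
    exact ⟨t, rfl⟩
  let f : ℝ → ↥(range γ ∪ range δ) := fun t => ⟨(γ.trans δ).extend t, hmem t⟩
  have : Fact ((0 : ℝ) < 1) := ⟨one_pos⟩
  have hf01 : f 0 = f 1 := Subtype.ext (by simp [f])
  let g : AddCircle (1 : ℝ) → ↥(range γ ∪ range δ) := AddCircle.liftIco 1 0 f
  have hg : Continuous g := AddCircle.liftIco_zero_continuous hf01
    (((γ.trans δ).extend.continuous).subtype_mk _).continuousOn
  have hgx : ∀ x ∈ Ico (0 : ℝ) 1, g x = f x := fun x hx => AddCircle.liftIco_zero_coe_apply hx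
  have hinj : Function.Injective g := by
    intro a b hab
    obtain ⟨x, hx, rfl⟩ := AddCircle.eq_coe_Ico a
    obtain ⟨y, hy, rfl⟩ := AddCircle.eq_coe_Ico b
    rw [hgx x hx, hgx y hy] at hab
    have h := congrArg Subtype.val hab
    simp only [f] at h
    rw [Path.extend_apply _ ⟨hx.1, hx.2.le⟩, Path.extend_apply _ ⟨hy.1, hy.2.le⟩] at h
    rcases le_total x y with hxy | hxy
    · have := key _ _ hxy (fun h1 => hy.2.ne (congrArg Subtype.val h1)) h
      rw [show x = y from congrArg Subtype.val this]
    · have := key _ _ hxy (fun h1 => hx.2.ne (congrArg Subtype.val h1)) h.symm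
      rw [show y = x from congrArg Subtype.val this]
  have hsurj : Function.Surjective g := by
    rintro ⟨z, hz⟩
    rw [← hrange] at hz
    obtain ⟨t, rfl⟩ := hz
    by_cases ht : t = 1
    · refine ⟨((0 : ℝ) : AddCircle (1 : ℝ)), ?_⟩
      rw [hgx 0 (by norm_num)]
      exact Subtype.ext (by simp [f, ht])
    · have ht1 : (t : ℝ) ∈ Ico (0 : ℝ) 1 :=
        ⟨t.2.1, lt_of_le_of_ne t.2.2 fun h => ht (Subtype.ext h)⟩
      refine ⟨((t : ℝ) : AddCircle (1 : ℝ)), ?_⟩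
      rw [hgx _ ht1]
      exact Subtype.ext (by simp [f])
  exact ⟨(hg.homeoOfEquivCompactToT2 (f := Equiv.ofBijective g ⟨hinj, hsurj⟩)).symm.trans
    (AddCircle.homeomorphCircle one_ne_zero)⟩

/-- A cyclic chain of arcs, consecutive ones sharing just an end, forms a circle. -/
theorem nonempty_homeomorph_circle_of_necklace {n : ℕ} (p : ℕ → X) (L : ℕ → Set X)
    (hp : p (n + 2) = p 0) (hL : ∀ j < n + 2, IsArc (L j) (p j) (p (j + 1)))
    (hint : ∀ i j, i < j → j < n + 2 → ∀ x ∈ L i ∩ L j,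
      (x = p j ∧ j = i + 1) ∨ (x = p 0 ∧ i = 0 ∧ j = n + 1))
    (hT2 : T2Space ↥(⋃ j < n + 2, L j)) : Nonempty (↥(⋃ j < n + 2, L j) ≃ₜ Circle) := by
  -- All links but the last concatenate to one arc, which the last link closes up.
  have harc : ∀ m ≤ n, IsArc (⋃ j < m + 1, L j) (p 0) (p (m + 1)) := by
    intro m hm
    induction m with
    | zero => simpa using hL 0 (by omega)
    | succ m ih =>
      rw [biUnion_lt_succ]
      refine (ih (by omega)).trans (hL _ (by omega)) ?_
      rintro x ⟨hx, hx'⟩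
      simp only [mem_iUnion] at hx
      obtain ⟨j, hj, hx⟩ := hx
      rcases hint j (m + 1) hj (by omega) x ⟨hx, hx'⟩ with h | h
      · exact h.1
      · omega
  have heq : ⋃ j < n + 2, L j = (⋃ j < n + 1, L j) ∪ L (n + 1) := biUnion_lt_succ L (n + 1)
  rw [heq] at hT2 ⊢
  refine (harc n le_rfl).nonempty_homeomorph_circle (hp ▸ hL (n + 1) (by omega)) ?_
  rintro x ⟨hx, hx'⟩
  simp only [mem_iUnion] at hx
  obtain ⟨j, hj, hx⟩ := hx
  rcases hint j (n + 1) hj (by omega) x ⟨hx, hx'⟩ with h | h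
  · exact Or.inr h.1
  · exact Or.inl h.1

end Arc

/-! ### Arcs along edges and rays -/

/-- The vertex `v` as a point of `|G|`. -/
noncomputable def vertexPt (G : SimpleGraph V) (v : V) : EndCompl G :=
  .pt (pointOf v) (Or.inl ⟨v, rfl⟩)

/-- The closed edge `uv` in `|G|`. -/
def edgePts (G : SimpleGraph V) (u v : V) : Set (EndCompl G) :=
  ptsIn G (segment ℝ (pointOf u) (pointOf v))

theorem segment_subset_complexPts {G : SimpleGraph V} {u v : V} (h : G.Adj u v) :
    segment ℝ (pointOf u) (pointOf v) ⊆ complexPts G := by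
  rw [← insert_endpoints_openSegment]
  rintro x (rfl | rfl | hx)
  · exact Or.inl ⟨u, rfl⟩
  · exact Or.inl ⟨v, rfl⟩
  · exact Or.inr ⟨u, v, h, hx⟩

theorem lineMap_pointOf_apply (u v w : V) (t : ℝ) :
    AffineMap.lineMap (pointOf u) (pointOf v) t w = (1 - t) * pointOf u w + t * pointOf v w := by
  rw [AffineMap.lineMap_apply_module]
  simp

theorem isArc_edgePts {G : SimpleGraph V} {u v : V} (h : G.Adj u v) :
    IsArc (edgePts G u v) (vertexPt G u) (vertexPt G v) := by
  classical
  have hmem : ∀ t : unitInterval,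
      AffineMap.lineMap (pointOf u) (pointOf v) (t : ℝ) ∈ segment ℝ (pointOf u) (pointOf v) := by
    intro t
    rw [segment_eq_image_lineMap]
    exact ⟨t, t.2, rfl⟩
  let f : unitInterval → EndCompl G := fun t =>
    .pt (AffineMap.lineMap (pointOf u) (pointOf v) (t : ℝ)) (segment_subset_complexPts h (hmem t))
  have hf : Continuous f := by
    rw [continuous_iff_continuousAt]
    intro t
    refine continuousAt_of_coord (f := f) rfl fun w => ?_
    change ContinuousAt
      (fun s : unitInterval => AffineMap.lineMap (pointOf u) (pointOf v) (s : ℝ) w) t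
    simp only [lineMap_pointOf_apply]
    fun_prop
  refine ⟨⟨⟨f, hf⟩, ?_, ?_⟩, ?_, ?_⟩
  · exact EndCompl.pt_ext fun w => by simp
  · exact EndCompl.pt_ext fun w => by simp
  · intro s t hst
    have := congrArg (EndCompl.coord v) hst
    change AffineMap.lineMap (pointOf u) (pointOf v) (s : ℝ) v =
      AffineMap.lineMap (pointOf u) (pointOf v) (t : ℝ) v at this
    simp only [lineMap_pointOf_apply] at this
    simp only [pointOf, Finsupp.single_apply, h.ne] at this
    exact Subtype.ext (by simpa using this)
  · ext p
    constructor
    · rintro ⟨t, rfl⟩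
      exact mem_ptsIn_pt.2 (hmem t)
    · rintro ⟨x, hx, rfl, hxs⟩
      rw [segment_eq_image_lineMap] at hxs
      obtain ⟨t, ht, rfl⟩ := hxs
      exact ⟨⟨t, ht⟩, rfl⟩

theorem pt_mem_edgePts_iff {G : SimpleGraph V} {u v : V} {x : V →₀ ℝ} {hx : x ∈ complexPts G} :
    EndCompl.pt x hx ∈ edgePts G u v ↔ x = pointOf u ∨ x = pointOf v ∨ x ∈ innerPts u v := by
  rw [edgePts, mem_ptsIn_pt, ← insert_endpoints_openSegment]
  rfl

theorem eq_or_eq_of_mem_edgePts {G : SimpleGraph V} {u v w : V} {p : EndCompl G}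
    (hp : p ∈ edgePts G u v) (hw : 0 < p.coord w) : w = u ∨ w = v := by
  cases p with
  | atEnd ε => exact absurd hw (lt_irrefl _)
  | pt x hx =>
    rcases pt_mem_edgePts_iff.1 hp with rfl | rfl | h
    · exact Or.inl (pointOf_pos_iff.1 hw)
    · exact Or.inr (pointOf_pos_iff.1 hw)
    · exact eq_or_eq_of_mem_innerPts h hw

theorem eq_vertexPt_of_forall_pos {G : SimpleGraph V} {x : V →₀ ℝ} (hx : x ∈ complexPts G) {v : V}
    (h : ∀ w, 0 < x w → w = v) : EndCompl.pt x hx = vertexPt G v := by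
  obtain rfl := eq_pointOf_of_forall_pos hx h
  rfl

/-- The points of the closed edges of a ray. -/
def Ray.pts {G : SimpleGraph V} (r : Ray G) : Set (EndCompl G) :=
  ⋃ n, edgePts G (r.vert n) (r.vert (n + 1))

open unitInterval in
-- Traverse the ray at one edge per unit of time and compress `[0, ∞)` to `[0, 1)` by `τ`, sending 1
-- to the end. Continuity at 1 holds because the last vertex passed eventually lies in the component
-- that belongs to the end.
theorem Ray.isArc {G : SimpleGraph V} (r : Ray G) :
    IsArc (insert (.atEnd r.toEnd) r.pts) (vertexPt G (r.vert 0)) (.atEnd r.toEnd) := by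
  classical
  -- the point reached at time `s` when each edge takes unit time
  let pos : ℝ → (V →₀ ℝ) := fun s => AffineMap.lineMap (pointOf (r.vert ⌊s⌋₊))
    (pointOf (r.vert (⌊s⌋₊ + 1))) (s - ⌊s⌋₊)
  have hpos : ∀ s, 0 ≤ s → pos s ∈ segment ℝ (pointOf (r.vert ⌊s⌋₊))
      (pointOf (r.vert (⌊s⌋₊ + 1))) := by
    intro s hs
    rw [segment_eq_image_lineMap]
    exact ⟨_, ⟨sub_nonneg.2 (Nat.floor_le hs), by linarith [Nat.lt_floor_add_one s]⟩, rfl⟩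
  have hposG : ∀ s, 0 ≤ s → pos s ∈ complexPts G := fun s hs =>
    segment_subset_complexPts (r.adj _) (hpos s hs)
  -- The hat function shows that the jumps of the floor are harmless: every coordinate is continuous
  -- in `s`.
  have hcoord : ∀ s, 0 ≤ s → ∀ m, pos s (r.vert m) = max 0 (1 - |s - m|) := by
    intro s hs m
    have h1 := Nat.floor_le hs
    have h2 := Nat.lt_floor_add_one s
    simp only [pos, lineMap_pointOf_apply]
    simp only [pointOf, Finsupp.single_apply, r.inj.eq_iff]
    generalize ⌊s⌋₊ = k at h1 h2
    rcases lt_trichotomy m k with hlt | rfl | hgt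
    · rw [if_neg hlt.ne', if_neg (by omega)]
      have : (m : ℝ) + 1 ≤ k := by exact_mod_cast hlt
      rw [abs_of_nonneg (by linarith), max_eq_left (by linarith)]
      ring
    · rw [if_pos rfl, if_neg (by omega), abs_of_nonneg (by linarith), max_eq_right (by linarith)]
      ring
    · rw [if_neg hgt.ne]
      rcases eq_or_lt_of_le (Nat.succ_le_of_lt hgt) with rfl | hlt
      · rw [if_pos rfl]
        push_cast
        rw [abs_of_nonpos (by linarith), max_eq_right (by linarith)]
        ring
      · rw [if_neg (by omega)]
        have : (k : ℝ) + 2 ≤ m := by exact_mod_cast hlt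
        rw [abs_of_nonpos (by linarith), max_eq_left (by linarith)]
        ring
  have hcoord' : ∀ s w, (∀ m, r.vert m ≠ w) → pos s w = 0 := by
    intro s w hw
    simp only [pos, lineMap_pointOf_apply]
    simp [pointOf, hw]
  have hfloor : ∀ s, 0 ≤ s → 0 < pos s (r.vert ⌊s⌋₊) := by
    intro s hs
    rw [hcoord s hs]
    have h1 := Nat.floor_le hs
    have h2 := Nat.lt_floor_add_one s
    rw [abs_of_nonneg (by linarith)]
    exact lt_max_of_lt_right (by linarith)
  have hposinj : ∀ s t, 0 ≤ s → 0 ≤ t → s ≤ t → pos s = pos t → s = t := by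
    intro s t hs ht hst h
    have e1 := hcoord s hs ⌊t⌋₊
    have e2 := hcoord s hs (⌊t⌋₊ + 1)
    rw [h, hcoord t ht] at e1 e2
    have h1 := Nat.floor_le ht
    have h2 := Nat.lt_floor_add_one t
    push_cast at e1 e2
    rw [abs_of_nonneg (by linarith), max_eq_right (by linarith)] at e1
    rw [abs_of_nonpos (a := t - (_ + 1)) (by linarith), max_eq_right (by linarith)] at e2
    rcases le_total s ⌊t⌋₊ with h3 | h3
    · rw [abs_of_nonpos (by linarith)] at e1 e2
      rcases max_cases (0 : ℝ) (1 - -(s - ((⌊t⌋₊ : ℝ) + 1))) with h4 | h4 <;>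
        rcases max_cases (0 : ℝ) (1 - -(s - (⌊t⌋₊ : ℝ))) with h5 | h5 <;> linarith
    · rw [abs_of_nonneg (by linarith)] at e1
      rcases max_cases (0 : ℝ) (1 - (s - (⌊t⌋₊ : ℝ))) with h4 | h4 <;> linarith
  let τ : ℝ → ℝ := fun t => 1 / (1 - t) - 1
  have hτ : ∀ t ∈ Ico (0 : ℝ) 1, 0 ≤ τ t := by
    intro t ht
    have : 0 < 1 - t := by linarith [ht.2]
    simp only [τ]
    rw [sub_nonneg, le_div_iff₀ this]
    linarith [ht.1]
  have hτI : ∀ t : I, t ≠ 1 → (t : ℝ) ∈ Ico (0 : ℝ) 1 := fun t ht =>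
    ⟨t.2.1, lt_of_le_of_ne t.2.2 fun h => ht (Subtype.ext h)⟩
  let f : I → EndCompl G := fun t =>
    if ht : t = 1 then .atEnd r.toEnd else .pt (pos (τ t)) (hposG _ (hτ _ (hτI t ht)))
  have hf1 : f 1 = .atEnd r.toEnd := dif_pos rfl
  have hft : ∀ t (ht : t ≠ 1), f t = .pt (pos (τ t)) (hposG _ (hτ _ (hτI t ht))) :=
    fun t ht => dif_neg ht
  have hf : Continuous f := by
    rw [continuous_iff_continuousAt]
    intro t
    by_cases ht : t = 1
    · subst ht
      refine continuousAt_of_endNhd hf1 fun F => ?_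
      obtain ⟨N, hN⟩ := EndSpace.comp_spec r.toEnd F r rfl
      -- For `z < 1` this bound says exactly that `τ z > N`.
      have hlt : ∀ᶠ z : I in 𝓝 1, 1 - (z : ℝ) < 1 / (N + 1) := by
        have : ContinuousAt (fun z : I => 1 - (z : ℝ)) 1 := by fun_prop
        refine this.eventually_lt_const ?_
        simp only [Icc.coe_one, sub_self]
        positivity
      filter_upwards [hlt] with z hz
      by_cases hz1 : z = 1
      · rw [hz1, hf1]
        exact atEnd_mem_endNhd_iff.2 rfl
      · rw [hft z hz1, pt_mem_endNhd_iff]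
        have hz2 := hτI z hz1
        refine ⟨r.vert ⌊τ z⌋₊, hN _ (Nat.le_floor ?_), hfloor _ (hτ _ hz2)⟩
        have h0 : 0 < 1 - (z : ℝ) := by linarith [hz2.2]
        have : (N + 1 : ℝ) < 1 / (1 - z) := by
          rw [lt_div_iff₀ (by positivity)] at hz
          rw [lt_div_iff₀ h0]
          linarith
        simp only [τ]
        linarith
    · refine continuousAt_of_coord (hft t ht) fun w => ?_
      have hne : ∀ᶠ z : I in 𝓝 t, z ≠ 1 := isOpen_ne.mem_nhds ht
      by_cases hw : ∃ m, r.vert m = w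
      · obtain ⟨m, rfl⟩ := hw
        have hc : ContinuousAt (fun z : I => max 0 (1 - |τ z - m|)) t := by
          have h0 : 1 - (t : ℝ) ≠ 0 := by linarith [(hτI t ht).2]
          have : ContinuousAt (fun z : I => τ z) t := by
            refine ContinuousAt.sub (ContinuousAt.div₀ continuousAt_const ?_ h0) continuousAt_const
            fun_prop
          fun_prop
        refine hc.congr ?_
        filter_upwards [hne] with z hz
        rw [hft z hz]
        exact (hcoord _ (hτ _ (hτI z hz)) m).symm
      · push Not at hw
        refine (continuousAt_const (y := (0 : ℝ))).congr ?_
        filter_upwards [hne] with z hz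
        rw [hft z hz]
        exact (hcoord' _ w hw).symm
  refine ⟨⟨⟨f, hf⟩, ?_, hf1⟩, ?_, ?_⟩
  · change f 0 = _
    rw [hft 0 zero_ne_one]
    refine EndCompl.pt_ext fun w => ?_
    simp [τ, pos]
  · intro s t hst
    change f s = f t at hst
    by_cases hs : s = 1 <;> by_cases ht : t = 1
    · rw [hs, ht]
    · rw [hs, hf1, hft t ht] at hst
      cases hst
    · rw [ht, hf1, hft s hs] at hst
      cases hst
    · rw [hft s hs, hft t ht, EndCompl.pt.injEq] at hst
      have h1 := hτ _ (hτI s hs)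
      have h2 := hτ _ (hτI t ht)
      have heq : τ s = τ t := by
        rcases le_total (τ s) (τ t) with h | h
        · exact hposinj _ _ h1 h2 h hst
        · exact (hposinj _ _ h2 h1 h hst.symm).symm
      simp only [τ, sub_left_inj, one_div, inv_inj, sub_right_inj] at heq
      exact Subtype.ext heq
  · ext p
    constructor
    · rintro ⟨t, rfl⟩
      change f t ∈ _
      by_cases ht : t = 1
      · rw [ht, hf1]; exact Or.inl rfl
      · rw [hft t ht]
        exact Or.inr (mem_iUnion.2 ⟨⌊τ t⌋₊, mem_ptsIn_pt.2 (hpos _ (hτ _ (hτI t ht)))⟩)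
    · have hsurj : ∀ s (hs : 0 ≤ s), EndCompl.pt (pos s) (hposG s hs) ∈ range f := by
        intro s hs
        have h1 : (0 : ℝ) < s + 1 := by linarith
        have h2 : 1 - 1 / (s + 1) ∈ Ico (0 : ℝ) 1 := by
          constructor
          · rw [sub_nonneg, div_le_one h1]; linarith
          · linarith [one_div_pos.2 h1]
        refine ⟨⟨_, h2.1, h2.2.le⟩, ?_⟩
        rw [hft _ fun h => h2.2.ne (congrArg Subtype.val h)]
        refine EndCompl.pt_ext fun w => ?_
        have : τ (1 - 1 / (s + 1)) = s := by
          simp [τ]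
        simp only [this]
      rintro (rfl | hp)
      · exact ⟨1, hf1⟩
      · obtain ⟨n, x, hx, rfl, hxs⟩ := mem_iUnion.1 hp
        rw [segment_eq_image_lineMap] at hxs
        obtain ⟨t, ht, rfl⟩ := hxs
        have hnt : (0 : ℝ) ≤ n + t := by linarith [ht.1, n.cast_nonneg (α := ℝ)]
        suffices h : EndCompl.pt _ hx = EndCompl.pt _ (hposG (n + t) hnt) by
          rw [h]; exact hsurj _ hnt
        refine EndCompl.pt_ext fun w => ?_
        -- At `t = 1` the floor has already moved on, and the point is the start of the next edge.
        rcases eq_or_lt_of_le ht.2 with rfl | ht1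
        · have : ⌊(n : ℝ) + 1⌋₊ = n + 1 := by
            exact_mod_cast Nat.floor_natCast (R := ℝ) (n + 1)
          simp [pos, this]
        · have : ⌊(n : ℝ) + t⌋₊ = n := by
            rw [Nat.floor_eq_iff hnt]
            exact ⟨by linarith [ht.1], by linarith⟩
          simp [pos, this]

/-! ### Robustly connected vertex sets -/

/-- `a` and `b` are joined by a walk of `G` inside `P`. -/
def LinkedIn (G : SimpleGraph V) (P : Set V) (a b : V) : Prop :=
  ∃ w : G.Walk a b, ∀ z ∈ w.support, z ∈ P

theorem LinkedIn.refl {G : SimpleGraph V} {P : Set V} {a : V} (ha : a ∈ P) : LinkedIn G P a a :=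
  ⟨.nil, by simpa using ha⟩

theorem LinkedIn.symm {G : SimpleGraph V} {P : Set V} {a b : V} (h : LinkedIn G P a b) :
    LinkedIn G P b a := by
  obtain ⟨w, hw⟩ := h
  exact ⟨w.reverse, by simpa using hw⟩

theorem LinkedIn.trans {G : SimpleGraph V} {P : Set V} {a b c : V} (h : LinkedIn G P a b)
    (h' : LinkedIn G P b c) : LinkedIn G P a c := by
  obtain ⟨w, hw⟩ := h
  obtain ⟨w', hw'⟩ := h'
  refine ⟨w.append w', fun z hz => ?_⟩
  rcases (SimpleGraph.Walk.mem_support_append_iff _ _).1 hz with hz | hz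
  exacts [hw z hz, hw' z hz]

theorem LinkedIn.mono {G : SimpleGraph V} {P Q : Set V} {a b : V} (h : LinkedIn G P a b)
    (hPQ : P ⊆ Q) : LinkedIn G Q a b :=
  h.imp fun _ hw z hz => hPQ (hw z hz)

theorem LinkedIn.of_adj {G : SimpleGraph V} {P : Set V} {a b : V} (h : G.Adj a b) (ha : a ∈ P)
    (hb : b ∈ P) : LinkedIn G P a b :=
  ⟨h.toWalk, by simp [ha, hb]⟩

theorem LinkedIn.left_mem {G : SimpleGraph V} {P : Set V} {a b : V} (h : LinkedIn G P a b) :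
    a ∈ P := by
  obtain ⟨w, hw⟩ := h
  exact hw a w.start_mem_support

theorem LinkedIn.right_mem {G : SimpleGraph V} {P : Set V} {a b : V} (h : LinkedIn G P a b) :
    b ∈ P :=
  h.symm.left_mem

theorem LinkedIn.closed {G : SimpleGraph V} {P D : Set V} {a b : V} (h : LinkedIn G P a b)
    (hD : ∀ u ∈ D ∩ P, ∀ v ∈ P, G.Adj u v → v ∈ D) (ha : a ∈ D) : b ∈ D := by
  obtain ⟨w, hw⟩ := h
  induction w with
  | nil => exact ha
  | cons hadj p ih =>
    refine ih (hD _ ⟨ha, hw _ (by simp)⟩ _ (hw _ (by simp)) hadj) fun z hz => hw z ?_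
    simp [hz]

/-- Any two vertices of `C` are joined inside `U` even after deleting finitely many others. -/
def IsRobust (G : SimpleGraph V) (C U : Set V) : Prop :=
  ∀ F : Set V, F.Finite → ∀ a ∈ C \ F, ∀ b ∈ C \ F, LinkedIn G (U \ F) a b

theorem LinkedIn.mem_componentCompl {G : SimpleGraph V} {F : Set V} {a b : V}
    (h : LinkedIn G Fᶜ a b) {c : G.ComponentCompl F} (ha : a ∈ c) : b ∈ c := by
  refine h.closed (D := (c : Set V)) (fun u hu v hv huv => ?_) ha
  exact SimpleGraph.ComponentCompl.mem_of_adj _ _ hu.1 hv huv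

theorem componentCompl_unique {G : SimpleGraph V} {F : Set V} {c d : G.ComponentCompl F} {a : V}
    (hc : a ∈ c) (hd : a ∈ d) : c = d := by
  obtain ⟨_, h₁⟩ := hc
  obtain ⟨_, h₂⟩ := hd
  exact h₁.symm.trans h₂

theorem linkedIn_compl_of_mem_componentCompl {G : SimpleGraph V} {F : Set V}
    {c : G.ComponentCompl F} {a b : V} (ha : a ∈ c) (hb : b ∈ c) : LinkedIn G Fᶜ a b := by
  obtain ⟨ha', h₁⟩ := ha
  obtain ⟨hb', h₂⟩ := hb
  obtain ⟨w⟩ := SimpleGraph.ConnectedComponent.exact (h₁.trans h₂.symm)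
  let f : G.induce Fᶜ →g G := (SimpleGraph.Embedding.induce Fᶜ).toHom
  have hs := SimpleGraph.Walk.support_map f w
  refine ⟨w.map f, fun z hz => ?_⟩
  change z ∈ (w.map f).support at hz
  rw [hs, List.mem_map] at hz
  obtain ⟨y, -, rfl⟩ := hz
  exact y.2

/-- Two rays that meet a robust set infinitely often are equivalent. -/
theorem IsRobust.toEnd_eq {G : SimpleGraph V} {C U : Set V} (h : IsRobust G C U) {r s : Ray G}
    (hr : ∀ N, ∃ n, N ≤ n ∧ r.vert n ∈ C) (hs : ∀ N, ∃ n, N ≤ n ∧ s.vert n ∈ C) :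
    r.toEnd = s.toEnd := by
  refine Quotient.sound (s := raySetoid G) fun F => ?_
  obtain ⟨c, N, hN⟩ := r.exists_tailIn F
  obtain ⟨d, M, hM⟩ := s.exists_tailIn F
  obtain ⟨n, hn, hnC⟩ := hr N
  obtain ⟨m, hm, hmC⟩ := hs M
  have h₁ := hN n hn
  have h₂ := hM m hm
  have hlink := h F F.finite_toSet _ ⟨hnC, h₁.1⟩ _ ⟨hmC, h₂.1⟩
  have h₃ := (hlink.mono fun z hz => hz.2).mem_componentCompl h₁
  obtain rfl := componentCompl_unique h₂ h₃
  exact ⟨d, ⟨N, hN⟩, ⟨M, hM⟩⟩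

/-- Rays on different sides of a finite separator have different ends. -/
theorem toEnd_ne_of_separated {G : SimpleGraph V} {D F : Set V} (hF : F.Finite)
    (hD : ∀ u ∈ D, u ∉ F → ∀ v, v ∉ F → G.Adj u v → v ∈ D) {r s : Ray G}
    (hr : ∀ n, r.vert n ∈ D) (hs : ∀ n, s.vert n ∉ D) : r.toEnd ≠ s.toEnd := by
  intro h
  have heq : Ray.Equivalent r s := Quotient.exact (s := raySetoid G) h
  obtain ⟨c, ⟨N, hN⟩, ⟨M, hM⟩⟩ := heq hF.toFinset
  refine hs M ((linkedIn_compl_of_mem_componentCompl (hN N le_rfl) (hM M le_rfl)).closed ?_ (hr N))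
  intro u hu v hv huv
  exact hD u hu.1 (by simpa using hu.2) v (by simpa using hv) huv

/-! ### Covering a robust set by two rays -/

/-- A growing sequence of finite paths converges to a ray. -/
theorem exists_ray_of_prefix {G : SimpleGraph V} (P : ℕ → List V)
    (hP : ∀ n, P n <+: P (n + 1)) (hlen : ∀ n, n < (P n).length)
    (hchain : ∀ n, (P n).IsChain G.Adj) (hnodup : ∀ n, (P n).Nodup) :
    ∃ r : Ray G, (P 0).head? = some (r.vert 0) ∧ (∀ n, r.vert n ∈ P n) ∧
      ∀ n, ∀ z ∈ P n, z ∈ range r.vert := by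
  have hmono : ∀ m n, m ≤ n → P m <+: P n := by
    intro m n hmn
    induction n, hmn using Nat.le_induction with
    | base => exact List.prefix_rfl
    | succ n _ ih => exact ih.trans (hP n)
  have hget : ∀ m n (h : m < (P n).length), (P m)[m]'(hlen m) = (P n)[m] := by
    intro m n h
    rcases le_total m n with hmn | hmn
    · exact (hmono m n hmn).getElem (hlen m)
    · exact ((hmono n m hmn).getElem h).symm
  refine ⟨⟨fun m => (P m)[m]'(hlen m), ?_, ?_⟩, ?_, ?_, ?_⟩
  · intro m n hmn
    change (P m)[m]'(hlen m) = (P n)[n]'(hlen n) at hmn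
    have h1 : m < (P (max m n)).length := (le_max_left m n).trans_lt (hlen _)
    have h2 : n < (P (max m n)).length := (le_max_right m n).trans_lt (hlen _)
    rw [hget m _ h1, hget n _ h2] at hmn
    exact (hnodup _).getElem_inj_iff.1 hmn
  · intro n
    have h2 := hlen (n + 1)
    rw [hget n (n + 1) (by omega)]
    exact (hchain (n + 1)).getElem n h2
  · rw [List.head?_eq_getElem?]
    exact List.getElem?_eq_getElem (hlen 0)
  · intro n
    exact List.getElem_mem _
  · intro n z hz
    obtain ⟨m, hm, rfl⟩ := List.getElem_of_mem hz
    exact ⟨m, hget m n hm⟩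

/-- `p` is a nonempty finite path of `G` inside `P` that ends in `C`. -/
def IsPathInto (G : SimpleGraph V) (P C : Set V) (p : List V) : Prop :=
  p.IsChain G.Adj ∧ p.Nodup ∧ (∀ z ∈ p, z ∈ P) ∧ ∃ p₀, ∃ h ∈ C, p = p₀ ++ [h]

/-- One step of the sweep. Deleting `F₀`, the other path `q` and all of `p` but its last vertex is a
finite deletion, so robustness continues `p` to another vertex of `C`, from where the step can be
repeated. -/
theorem IsRobust.exists_extension {G : SimpleGraph V} {C U F₀ : Set V} (h : IsRobust G C U)
    (hC : C.Infinite) (hF₀ : F₀.Finite) {p q : List V} (hp : IsPathInto G (U \ F₀) C p)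
    (hpq : p.Disjoint q) (t : V) :
    ∃ p', IsPathInto G (U \ F₀) C p' ∧ p'.Disjoint q ∧ p <+: p' ∧ p.length < p'.length ∧
      (t ∈ C \ F₀ → t ∈ p' ∨ t ∈ q) := by
  classical
  obtain ⟨hchain, hnodup, hsub, p₀, a, haC, rfl⟩ := hp
  let F : Set V := F₀ ∪ {z | z ∈ p₀ ++ q}
  have hF : F.Finite := hF₀.union (List.finite_toSet _)
  have haF : a ∉ F := by
    rintro (ha | ha)
    · exact (hsub a (by simp)).2 ha
    · rcases List.mem_append.1 ha with ha | ha
      · exact (List.nodup_append.1 hnodup).2.2 a ha a (by simp) rfl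
      · exact hpq (by simp) ha
  -- Aim at `t` if it is still free, and otherwise at any fresh vertex of `C`, so that the path
  -- grows in every case.
  obtain ⟨b, hbC, hba, hbt⟩ : ∃ b ∈ C \ F, b ≠ a ∧ (t ∈ C \ F → t = b ∨ t = a) := by
    by_cases ht : t ∈ C \ F ∧ t ≠ a
    · exact ⟨t, ht.1, ht.2, fun _ => Or.inl rfl⟩
    · obtain ⟨b, hb, hbF⟩ := hC.exists_notMem_finite (hF.insert a)
      rw [mem_insert_iff, not_or] at hbF
      refine ⟨b, ⟨hb, hbF.2⟩, hbF.1, fun h => Or.inr ?_⟩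
      by_contra hne
      exact ht ⟨h, hne⟩
  obtain ⟨w, hw⟩ := h F hF a ⟨haC, haF⟩ b hbC
  have hbyp : ∀ z ∈ w.bypass.support, z ∈ U \ F := fun z hz =>
    hw z (w.support_bypass_subset_support hz)
  have hpath := w.bypass_isPath
  generalize w.bypass = w' at hbyp hpath
  cases w' with
  | nil => exact absurd rfl hba
  | cons hadj w'' =>
    set l := w''.support with hl
    have hsupp : (SimpleGraph.Walk.cons hadj w'').support = a :: l := rfl
    have hch := (SimpleGraph.Walk.cons hadj w'').isChain_adj_support
    have hnd := hpath.support_nodup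
    rw [hsupp] at hbyp hch hnd
    have hlne : l ≠ [] := w''.support_ne_nil
    have hbl : b ∈ l := w''.end_mem_support
    refine ⟨p₀ ++ a :: l, ⟨?_, ?_, ?_, ?_⟩, ?_, ?_, ?_, ?_⟩
    · rw [List.isChain_append] at hchain ⊢
      exact ⟨hchain.1, hch, by simpa using hchain.2.2⟩
    · rw [List.nodup_append] at hnodup ⊢
      refine ⟨hnodup.1, hnd, ?_⟩
      rintro x hx y hy rfl
      exact (hbyp x hy).2 (Or.inr (List.mem_append_left _ hx))
    · intro z hz
      rcases List.mem_append.1 hz with hz | hz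
      · exact hsub z (by simp [hz])
      · exact ⟨(hbyp z hz).1, fun h' => (hbyp z hz).2 (Or.inl h')⟩
    · refine ⟨p₀ ++ a :: l.dropLast, b, hbC.1, ?_⟩
      have : l.dropLast ++ [b] = l := by
        rw [← w''.getLast_support]
        exact List.dropLast_append_getLast hlne
      rw [List.append_assoc, List.cons_append, this]
    · intro z hz hzq
      rcases List.mem_append.1 hz with hz | hz
      · exact hpq (by simp [hz]) hzq
      · exact (hbyp z hz).2 (Or.inr (List.mem_append_right _ hzq))
    · exact ⟨l, by simp⟩
    · have := List.length_pos_iff.2 hlne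
      simp only [List.length_append, List.length_cons, List.length_nil]
      omega
    · intro ht
      by_cases htF : t ∈ F
      · rcases htF with h' | h'
        · exact absurd h' ht.2
        · rcases List.mem_append.1 h' with h' | h'
          · exact Or.inl (by simp [h'])
          · exact Or.inr h'
      · rcases hbt ⟨ht.1, htF⟩ with rfl | rfl
        · exact Or.inl (by simp [hbl])
        · exact Or.inl (by simp)

/-- Extend two disjoint paths in turn, aiming in round `n` at the `n`-th vertex of an enumeration of
`V`; the limits are the rays. -/
theorem IsRobust.exists_rays [Countable V] {G : SimpleGraph V} {C U F₀ : Set V}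
    (h : IsRobust G C U) (hCU : C ⊆ U) (hC : C.Infinite) (hF₀ : F₀.Finite) {x y : V}
    (hx : x ∈ C \ F₀) (hy : y ∈ C \ F₀) (hxy : x ≠ y) :
    ∃ r s : Ray G, r.vert 0 = x ∧ s.vert 0 = y ∧ (∀ n, r.vert n ∈ U \ F₀) ∧
      (∀ n, s.vert n ∈ U \ F₀) ∧ (∀ m n, r.vert m ≠ s.vert n) ∧
      ∀ c ∈ C \ F₀, c ∈ range r.vert ∪ range s.vert := by
  have : Nonempty V := ⟨x⟩
  obtain ⟨t, ht⟩ := exists_surjective_nat V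
  let State := {pq : List V × List V // IsPathInto G (U \ F₀) C pq.1 ∧
    IsPathInto G (U \ F₀) C pq.2 ∧ pq.1.Disjoint pq.2}
  have hstep : ∀ (a : V) (σ : State), ∃ σ' : State, σ.1.1 <+: σ'.1.1 ∧ σ.1.2 <+: σ'.1.2 ∧
      σ.1.1.length < σ'.1.1.length ∧ σ.1.2.length < σ'.1.2.length ∧
      (a ∈ C \ F₀ → a ∈ σ'.1.1 ∨ a ∈ σ'.1.2) := by
    rintro a ⟨⟨p, q⟩, hp, hq, hpq⟩
    -- The covering clause of this first extension is not needed: that of the second already has `a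
    -- ∈ p'` as an alternative.
    obtain ⟨p', hp', hpq', hpp', hlp, -⟩ := h.exists_extension hC hF₀ hp hpq a
    obtain ⟨q', hq', hqp', hqq', hlq, hcov⟩ := h.exists_extension hC hF₀ hq hpq'.symm a
    exact ⟨⟨(p', q'), hp', hq', hqp'.symm⟩, hpp', hqq', hlp, hlq, fun ha => (hcov ha).symm⟩
  choose next hn₁ hn₂ hn₃ hn₄ hn₅ using hstep
  have hsingle : ∀ z ∈ C \ F₀, IsPathInto G (U \ F₀) C [z] := fun z hz =>
    ⟨by simp, by simp, by simpa using ⟨hCU hz.1, hz.2⟩, [], z, hz.1, rfl⟩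
  let seq : ℕ → State := fun n => Nat.rec
    ⟨([x], [y]), hsingle x hx, hsingle y hy, by simpa using hxy.symm⟩ (fun n σ => next (t n) σ) n
  have hlen₁ : ∀ n, n < (seq n).1.1.length := by
    intro n
    induction n with
    | zero => simp [seq]
    | succ n ih => exact (Nat.succ_le_of_lt ih).trans_lt (hn₃ (t n) (seq n))
  have hlen₂ : ∀ n, n < (seq n).1.2.length := by
    intro n
    induction n with
    | zero => simp [seq]
    | succ n ih => exact (Nat.succ_le_of_lt ih).trans_lt (hn₄ (t n) (seq n))
  obtain ⟨r, hr₀, hr₁, hr₂⟩ := exists_ray_of_prefix (G := G) (fun n => (seq n).1.1)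
    (fun n => hn₁ (t n) (seq n)) hlen₁ (fun n => (seq n).2.1.1) (fun n => (seq n).2.1.2.1)
  obtain ⟨s, hs₀, hs₁, hs₂⟩ := exists_ray_of_prefix (G := G) (fun n => (seq n).1.2)
    (fun n => hn₂ (t n) (seq n)) hlen₂ (fun n => (seq n).2.2.1.1) (fun n => (seq n).2.2.1.2.1)
  have hmono : ∀ m n, m ≤ n → (seq m).1.1 <+: (seq n).1.1 ∧ (seq m).1.2 <+: (seq n).1.2 := by
    intro m n hmn
    induction n, hmn using Nat.le_induction with
    | base => exact ⟨List.prefix_rfl, List.prefix_rfl⟩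
    | succ n _ ih =>
      exact ⟨ih.1.trans (hn₁ (t n) (seq n)), ih.2.trans (hn₂ (t n) (seq n))⟩
  refine ⟨r, s, ?_, ?_, fun n => (seq n).2.1.2.2.1 _ (hr₁ n),
    fun n => (seq n).2.2.1.2.2.1 _ (hs₁ n), ?_, ?_⟩
  · simpa [seq, eq_comm] using hr₀
  · simpa [seq, eq_comm] using hs₀
  · intro m n hmn
    have h₁ := (hmono m (max m n) (le_max_left _ _)).1.subset (hr₁ m)
    have h₂ := (hmono n (max m n) (le_max_right _ _)).2.subset (hs₁ n)
    rw [← hmn] at h₂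
    exact (seq (max m n)).2.2.2 h₁ h₂
  · intro c hc
    obtain ⟨n, rfl⟩ := ht c
    rcases hn₅ (t n) (seq n) hc with h' | h'
    · exact Or.inl (hr₂ (n + 1) _ h')
    · exact Or.inr (hs₂ (n + 1) _ h')

/-! ### Links of a circle -/

theorem edgeMeets_edgePts {G : SimpleGraph V} {u v : V} (h : G.Adj u v) :
    EdgeMeets G (edgePts G u v) u v := by
  have hx : (1 / 2 : ℝ) • pointOf u + (1 / 2 : ℝ) • pointOf v ∈ innerPts u v :=
    ⟨1 / 2, 1 / 2, by norm_num, by norm_num, by norm_num, rfl⟩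
  refine ⟨h, .pt _ (Or.inr ⟨u, v, h, hx⟩), ?_, mem_ptsIn_pt.2 hx⟩
  exact pt_mem_edgePts_iff.2 (Or.inr (Or.inr hx))

theorem EdgeMeets.mono {G : SimpleGraph V} {C D : Set (EndCompl G)} {u v : V}
    (h : EdgeMeets G C u v) (hCD : C ⊆ D) : EdgeMeets G D u v :=
  ⟨h.1, h.2.imp fun _ hp => ⟨hCD hp.1, hp.2⟩⟩

theorem EdgeMeets.exists_coord_pos {G : SimpleGraph V} {C : Set (EndCompl G)} {u v : V}
    (h : EdgeMeets G C u v) : ∃ p ∈ C, 0 < p.coord u ∧ 0 < p.coord v := by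
  obtain ⟨-, p, hp, x, hx, rfl, hin⟩ := h
  exact ⟨_, hp, pos_of_mem_innerPts hin⟩

theorem coord_vertexPt_pos_iff {G : SimpleGraph V} {v w : V} :
    0 < (vertexPt G v).coord w ↔ w = v :=
  pointOf_pos_iff

theorem Ray.mem_range_of_coord_pos {G : SimpleGraph V} {r : Ray G} {p : EndCompl G}
    (hp : p ∈ r.pts) {w : V} (hw : 0 < p.coord w) : w ∈ range r.vert := by
  obtain ⟨n, hn⟩ := mem_iUnion.1 hp
  rcases eq_or_eq_of_mem_edgePts hn hw with rfl | rfl <;> exact mem_range_self _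

theorem Ray.finite_edgeMeets {G : SimpleGraph V} (r : Ray G) (w : V) :
    {z | EdgeMeets G r.pts w z}.Finite := by
  by_cases h : w ∈ range r.vert
  · obtain ⟨m, rfl⟩ := h
    refine ((finite_le_nat (m + 1)).image r.vert).subset ?_
    intro z hz
    obtain ⟨p, hp, h₁, h₂⟩ := hz.exists_coord_pos
    obtain ⟨n, hn⟩ := mem_iUnion.1 hp
    have hm : n ≤ m := by
      rcases eq_or_eq_of_mem_edgePts hn h₁ with h | h
      · exact (r.inj h).ge
      · have := r.inj h
        omega
    rcases eq_or_eq_of_mem_edgePts hn h₂ with h | h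
    · exact ⟨n, by simp only [mem_ofPred_eq]; omega, h.symm⟩
    · exact ⟨n + 1, by simp only [mem_ofPred_eq]; omega, h.symm⟩
  · convert finite_empty
    ext z
    refine iff_of_false (fun hz => h ?_) (notMem_empty z)
    obtain ⟨p, hp, h₁, -⟩ := EdgeMeets.exists_coord_pos hz
    exact Ray.mem_range_of_coord_pos hp h₁

theorem Ray.atEnd_notMem_pts {G : SimpleGraph V} {r : Ray G} {ε : EndSpace G} :
    EndCompl.atEnd ε ∉ r.pts := by
  intro h
  obtain ⟨n, hn⟩ := mem_iUnion.1 h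
  exact atEnd_notMem_ptsIn hn

/-- An arc of `|G|` between two vertices whose vertices are those in `W` and whose ends are in `E`,
locally finite and without isolated vertices. -/
structure IsLink (G : SimpleGraph V) (L : Set (EndCompl G)) (W : Set V) (E : Set (EndSpace G))
    (u v : V) : Prop where
  isArc : IsArc L (vertexPt G u) (vertexPt G v)
  mem_of_coord_pos : ∀ p ∈ L, ∀ w, 0 < p.coord w → w ∈ W
  mem_of_atEnd : ∀ ε, EndCompl.atEnd ε ∈ L → ε ∈ E
  exists_edgeMeets : ∀ w ∈ W, ∃ z, EdgeMeets G L w z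
  finite_edgeMeets : ∀ w, {z | EdgeMeets G L w z}.Finite

theorem IsLink.left_mem {G : SimpleGraph V} {L : Set (EndCompl G)} {W : Set V}
    {E : Set (EndSpace G)} {u v : V} (h : IsLink G L W E u v) : u ∈ W :=
  h.mem_of_coord_pos _ h.isArc.left_mem u (coord_vertexPt_pos_iff.2 rfl)

theorem isLink_of_adj {G : SimpleGraph V} {u v w : V} (huv : G.Adj u v) (hvw : G.Adj v w)
    (huw : u ≠ w) :
    IsLink G (edgePts G u v ∪ edgePts G v w) {u, v, w} ∅ u w := by
  have hmem : ∀ p ∈ edgePts G u v ∪ edgePts G v w, ∀ z, 0 < p.coord z →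
      z ∈ ({u, v, w} : Set V) := by
    rintro p (hp | hp) z hz <;> rcases eq_or_eq_of_mem_edgePts hp hz with rfl | rfl <;> simp
  refine ⟨(isArc_edgePts huv).trans (isArc_edgePts hvw) ?_, hmem, ?_, ?_, ?_⟩
  · rintro p ⟨h₁, h₂⟩
    cases p with
    | atEnd ε => exact absurd h₁ atEnd_notMem_ptsIn
    | pt x hx =>
      refine eq_vertexPt_of_forall_pos hx fun z hz => ?_
      rcases eq_or_eq_of_mem_edgePts h₁ hz with rfl | rfl
      · rcases eq_or_eq_of_mem_edgePts h₂ hz with rfl | rfl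
        · rfl
        · exact absurd rfl huw
      · rfl
  · rintro ε (h | h) <;> exact absurd h atEnd_notMem_ptsIn
  · have h₁ := (edgeMeets_edgePts huv).mono (subset_union_left (t := edgePts G v w))
    have h₂ := (edgeMeets_edgePts hvw).mono (subset_union_right (s := edgePts G u v))
    rintro z (rfl | rfl | rfl)
    exacts [⟨_, h₁⟩, ⟨_, h₂⟩, ⟨_, h₂.symm⟩]
  · intro z
    refine (toFinite ({u, v, w} : Set V)).subset fun y hy => ?_
    obtain ⟨p, hp, -, hpy⟩ := EdgeMeets.exists_coord_pos hy
    exact hmem p hp y hpy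

/-- The arc of `r` and the reversed arc of `s` meet only in the common end. This double ray takes
the place of a 2-path of the finite cycle. -/
theorem isLink_of_rays {G : SimpleGraph V} {r s : Ray G} (hrs : r.toEnd = s.toEnd)
    (hdisj : ∀ m n, r.vert m ≠ s.vert n) :
    IsLink G (insert (.atEnd r.toEnd) r.pts ∪ insert (.atEnd r.toEnd) s.pts)
      (range r.vert ∪ range s.vert) {r.toEnd} (r.vert 0) (s.vert 0) := by
  have hs := s.isArc
  rw [← hrs] at hs
  have hrL : r.pts ⊆ insert (.atEnd r.toEnd) r.pts ∪ insert (.atEnd r.toEnd) s.pts :=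
    (subset_insert _ _).trans subset_union_left
  have hsL : s.pts ⊆ insert (.atEnd r.toEnd) r.pts ∪ insert (.atEnd r.toEnd) s.pts :=
    (subset_insert _ _).trans subset_union_right
  refine ⟨r.isArc.trans hs.symm ?_, ?_, ?_, ?_, ?_⟩
  · rintro p ⟨rfl | h₁, h₂ | h₂⟩
    · rfl
    · rfl
    · exact h₂
    · cases p with
      | atEnd ε => exact absurd h₁ Ray.atEnd_notMem_pts
      | pt x hx =>
        obtain ⟨v, hv⟩ := complexPts_exists_pos hx
        obtain ⟨m, rfl⟩ := Ray.mem_range_of_coord_pos h₁ hv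
        obtain ⟨n, hn⟩ := Ray.mem_range_of_coord_pos h₂ hv
        exact absurd hn.symm (hdisj m n)
  · rintro p ((rfl | hp) | (rfl | hp)) w hw
    · exact absurd hw (lt_irrefl _)
    · exact Or.inl (Ray.mem_range_of_coord_pos hp hw)
    · exact absurd hw (lt_irrefl _)
    · exact Or.inr (Ray.mem_range_of_coord_pos hp hw)
  · rintro ε ((h | h) | (h | h))
    · cases h; rfl
    · exact absurd h Ray.atEnd_notMem_pts
    · cases h; rfl
    · exact absurd h Ray.atEnd_notMem_pts
  · rintro w (⟨n, rfl⟩ | ⟨n, rfl⟩)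
    · exact ⟨_, (edgeMeets_edgePts (r.adj n)).mono ((subset_iUnion_of_subset n subset_rfl).trans hrL)⟩
    · exact ⟨_, (edgeMeets_edgePts (s.adj n)).mono ((subset_iUnion_of_subset n subset_rfl).trans hsL)⟩
  · intro w
    refine ((r.finite_edgeMeets w).union (s.finite_edgeMeets w)).subset ?_
    rintro z ⟨hadj, p, (rfl | hp) | (rfl | hp), hpz⟩
    · exact absurd hpz atEnd_notMem_ptsIn
    · exact Or.inl ⟨hadj, p, hp, hpz⟩
    · exact absurd hpz atEnd_notMem_ptsIn
    · exact Or.inr ⟨hadj, p, hp, hpz⟩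

/-- Rays alternate between the sides. So a ray inside `U` with `U ∩ A ⊆ C` meets `C` infinitely
often, as `IsRobust.toEnd_eq` requires. -/
theorem exists_mem_left_of_ray {G : SimpleGraph V} {A B : Set V} (hG : IsBipartition G A B)
    (r : Ray G) (N : ℕ) : ∃ n, N ≤ n ∧ r.vert n ∈ A := by
  rcases hG.2.mem_of_adj (r.adj N) with h | h
  · exact ⟨N, le_rfl, h.1⟩
  · exact ⟨N + 1, by omega, h.2⟩

/-- A finite cycle, some of whose 2-paths `a b a'` lie across disjoint robust sets, extends to a
topological cycle that also covers these robust sets. -/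
theorem exists_isTopCycle_of_cycle [Countable V] {G : SimpleGraph V} {A B : Set V}
    (hG : IsBipartition G A B) {n : ℕ} {a b : ℕ → V} (ha : ∀ j < n + 2, a j ∈ A)
    (hb : ∀ j < n + 2, b j ∈ B) (hcyc : a (n + 2) = a 0)
    (hab : ∀ j < n + 2, G.Adj (a j) (b j)) (hba : ∀ j < n + 2, G.Adj (b j) (a (j + 1)))
    (hainj : InjOn a (Iio (n + 2))) (hbinj : InjOn b (Iio (n + 2)))
    {ι : Type*} (C U : ι → Set V) (gap : ι → ℕ) (hgap : ∀ i, gap i < n + 2)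
    (hrob : ∀ i, IsRobust G (C i) (U i)) (hCU : ∀ i, C i ⊆ U i) (hCA : ∀ i, C i ⊆ A)
    (hUA : ∀ i, U i ∩ A ⊆ C i)
    (hCinf : ∀ i, (C i).Infinite) (hUdisj : ∀ i i', i ≠ i' → Disjoint (U i) (U i'))
    (hgap₁ : ∀ i, a (gap i) ∈ C i) (hgap₂ : ∀ i, a (gap i + 1) ∈ C i)
    (hsep : ∀ i i', i ≠ i' → ∃ F D : Set V, F.Finite ∧ U i ⊆ D ∧ Disjoint D (U i') ∧
      ∀ u ∈ D, u ∉ F → ∀ v, v ∉ F → G.Adj u v → v ∈ D)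
    (hcov : A ⊆ (⋃ i, C i) ∪ a '' Iio (n + 2)) :
    ∃ H : G.Subgraph, IsTopCycle H ∧ A ⊆ H.verts := by
  have hAB : ∀ v, v ∈ A → v ∈ B → False := fun v h₁ h₂ => Set.disjoint_left.1 hG.2.disjoint h₁ h₂
  have ha' : ∀ j ≤ n + 2, a j ∈ A := by
    intro j hj
    rcases hj.lt_or_eq with h | rfl
    · exact ha j h
    · exact hcyc ▸ ha 0 (by omega)
  have hne : ∀ j < n + 2, a j ≠ a (j + 1) := by
    intro j hj h
    rcases (Nat.succ_le_of_lt hj).lt_or_eq with h' | h'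
    · have := hainj hj h' h
      omega
    · rw [Nat.succ_eq_add_one] at h'
      rw [h', hcyc] at h
      have := hainj hj (show 0 < n + 2 by omega) h
      omega
  have hgapinj : ∀ i i', gap i = gap i' → i = i' := by
    intro i i' h
    by_contra hii
    exact Set.disjoint_left.1 (hUdisj i i' hii) (hCU i (hgap₁ i)) (hCU i' (h ▸ hgap₁ i'))
  let cyc : Set V := a '' Iio (n + 2) ∪ b '' Iio (n + 2)
  have hcycfin : cyc.Finite := ((finite_Iio _).image _).union ((finite_Iio _).image _)
  -- The rays avoid every vertex of the cycle except the two ends of the gap; the vertices of `C i`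
  -- thereby omitted stay on the cycle.
  have hrays : ∀ i, ∃ r s : Ray G, r.vert 0 = a (gap i) ∧ s.vert 0 = a (gap i + 1) ∧
      (∀ n, r.vert n ∈ U i \ (cyc \ {a (gap i), a (gap i + 1)})) ∧
      (∀ n, s.vert n ∈ U i \ (cyc \ {a (gap i), a (gap i + 1)})) ∧
      (∀ m n, r.vert m ≠ s.vert n) ∧
      ∀ c ∈ C i \ (cyc \ {a (gap i), a (gap i + 1)}), c ∈ range r.vert ∪ range s.vert := fun i =>
    (hrob i).exists_rays (hCU i) (hCinf i) (hcycfin.subset sdiff_subset)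
      ⟨hgap₁ i, fun h => h.2 (by simp)⟩ ⟨hgap₂ i, fun h => h.2 (by simp)⟩ (hne _ (hgap i))
  choose r s hr₀ hs₀ hrU hsU hrs hrscov using hrays
  have hends : ∀ i, (r i).toEnd = (s i).toEnd := by
    intro i
    refine (hrob i).toEnd_eq ?_ ?_ <;> intro N
    · obtain ⟨m, hm, hmA⟩ := exists_mem_left_of_ray hG (r i) N
      exact ⟨m, hm, hUA i ⟨(hrU i m).1, hmA⟩⟩
    · obtain ⟨m, hm, hmA⟩ := exists_mem_left_of_ray hG (s i) N
      exact ⟨m, hm, hUA i ⟨(hsU i m).1, hmA⟩⟩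
  have hendinj : ∀ i i', (r i).toEnd = (r i').toEnd → i = i' := by
    intro i i' h
    by_contra hii
    obtain ⟨F, D, hF, hUD, hDU, hclosed⟩ := hsep i i' hii
    exact toEnd_ne_of_separated hF hclosed (fun m => hUD (hrU i m).1)
      (fun m hm => Set.disjoint_left.1 hDU hm (hrU i' m).1) h
  -- the inner vertices of the `j`-th link
  let T : ℕ → V → Prop := fun j w => w = b j ∨ ∃ i, gap i = j ∧ w ∈ U i ∧ w ∉ cyc
  have hlinks : ∀ j, j < n + 2 → ∃ L W, IsLink G L W {ε | ∃ i, gap i = j ∧ ε = (r i).toEnd}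
      (a j) (a (j + 1)) ∧ (∀ w ∈ W, w = a j ∨ w = a (j + 1) ∨ T j w) ∧
      ∀ i, gap i = j → C i ⊆ W ∪ a '' Iio (n + 2) := by
    intro j hj
    by_cases hex : ∃ i, gap i = j
    · obtain ⟨i, rfl⟩ := hex
      have hlink := isLink_of_rays (hends i) (hrs i)
      rw [hr₀, hs₀] at hlink
      refine ⟨_, _, ⟨hlink.isArc, hlink.mem_of_coord_pos,
        fun ε hε => ⟨i, rfl, hlink.mem_of_atEnd ε hε⟩, hlink.exists_edgeMeets,
        hlink.finite_edgeMeets⟩, ?_, ?_⟩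
      · have key : ∀ w, w ∈ U i \ (cyc \ {a (gap i), a (gap i + 1)}) →
            w = a (gap i) ∨ w = a (gap i + 1) ∨ T (gap i) w := by
          intro w hw
          by_cases h₁ : w = a (gap i)
          · exact Or.inl h₁
          by_cases h₂ : w = a (gap i + 1)
          · exact Or.inr (Or.inl h₂)
          exact Or.inr (Or.inr (Or.inr ⟨i, rfl, hw.1, fun hc => hw.2 ⟨hc, by simp [h₁, h₂]⟩⟩))
        rintro w (⟨m, rfl⟩ | ⟨m, rfl⟩)
        exacts [key _ (hrU i m), key _ (hsU i m)]
      · intro i' hi' c hc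
        obtain rfl := hgapinj i' i hi'
        by_cases hcc : c ∈ cyc
        · rcases hcc with h | ⟨k, hk, rfl⟩
          · exact Or.inr h
          · exact (hAB _ (hCA i' hc) (hb k hk)).elim
        · exact Or.inl (hrscov i' c ⟨hc, fun h' => hcc h'.1⟩)
    · refine ⟨edgePts G (a j) (b j) ∪ edgePts G (b j) (a (j + 1)), {a j, b j, a (j + 1)}, ?_, ?_,
        fun i hi => absurd ⟨i, hi⟩ hex⟩
      · have hlink := isLink_of_adj (hab j hj) (hba j hj) (hne j hj)
        exact ⟨hlink.isArc, hlink.mem_of_coord_pos, fun ε hε => (hlink.mem_of_atEnd ε hε).elim,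
          hlink.exists_edgeMeets, hlink.finite_edgeMeets⟩
      · rintro w (rfl | rfl | rfl)
        exacts [Or.inl rfl, Or.inr (Or.inr (Or.inl rfl)), Or.inr (Or.inl rfl)]
  choose! L W hL hW hcovW using hlinks
  have hT : ∀ i j w, i < n + 2 → j < n + 2 → T i w → T j w → i = j := by
    intro i j w hi hj h₁ h₂
    rcases h₁ with rfl | ⟨k, rfl, hk, hkc⟩ <;> rcases h₂ with h₂ | ⟨l, rfl, hl, hlc⟩
    · exact hbinj hi hj h₂
    · exact absurd (Or.inr ⟨i, hi, rfl⟩) hlc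
    · exact absurd (Or.inr ⟨j, hj, h₂.symm⟩) hkc
    · by_contra hkl
      exact Set.disjoint_left.1 (hUdisj k l fun h => hkl (by rw [h])) hk hl
  have hTa : ∀ j k, j < n + 2 → k ≤ n + 2 → ¬ T j (a k) := by
    intro j k hj hk h
    rcases h with h | ⟨i, -, -, h⟩
    · exact hAB _ (ha' k hk) (h ▸ hb j hj)
    · rcases hk.lt_or_eq with h' | rfl
      · exact h (Or.inl ⟨k, h', rfl⟩)
      · exact h (Or.inl ⟨0, show 0 < n + 2 by omega, hcyc.symm⟩)
  -- Inner vertices of different links are distinct and none is an `a k`, so links share only the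
  -- vertices `a k` at which they are consecutive, including the wrap-around at `a 0`.
  have hWW : ∀ i j, i < j → j < n + 2 → ∀ w, w ∈ W i → w ∈ W j →
      (w = a j ∧ j = i + 1) ∨ (w = a 0 ∧ i = 0 ∧ j = n + 1) := by
    intro i j hij hj w hwi hwj
    have hi : i < n + 2 := by omega
    have hainj' : ∀ k l, k < n + 2 → l < n + 2 → a k = a l → k = l := fun k l hk hl h =>
      hainj hk hl h
    rcases hW i hi w hwi with rfl | rfl | h₁ <;> rcases hW j hj _ hwj with h₂ | h₂ | h₂
    · have := hainj' i j hi hj h₂; omega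
    · rcases (show j + 1 ≤ n + 2 by omega).lt_or_eq with h | h
      · have := hainj' i (j + 1) hi h h₂; omega
      · rw [h, hcyc] at h₂
        have := hainj' i 0 hi (by omega) h₂
        exact Or.inr ⟨h₂, this, by omega⟩
    · exact absurd h₂ (hTa j i hj (by omega))
    · exact Or.inl ⟨h₂, (hainj' _ _ (by omega) hj h₂).symm⟩
    · rcases (show j + 1 ≤ n + 2 by omega).lt_or_eq with h | h
      · have := hainj' (i + 1) (j + 1) (by omega) h h₂; omega
      · rw [h, hcyc] at h₂
        have := hainj' (i + 1) 0 (by omega) (by omega) h₂; omega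
    · exact absurd h₂ (hTa j (i + 1) hj (by omega))
    · exact absurd (h₂ ▸ h₁) (hTa i j hi (by omega))
    · exact absurd (h₂ ▸ h₁) (hTa i (j + 1) hi (by omega))
    · have := hT i j w hi hj h₁ h₂; omega
  let Z : Set (EndCompl G) := ⋃ j < n + 2, L j
  have hLZ : ∀ j < n + 2, L j ⊆ Z := fun j hj => subset_biUnion_of_mem (u := L) hj
  have hT2 : T2Space Z := by
    refine t2Space_of_locallyFinite fun v => ?_
    refine (Set.Finite.biUnion (finite_lt_nat (n + 2))
      fun j hj => (hL j hj).finite_edgeMeets v).subset ?_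
    rintro z ⟨hadj, p, hp, hpz⟩
    simp only [Z, mem_iUnion] at hp
    obtain ⟨j, hj, hp⟩ := hp
    exact mem_biUnion (show j ∈ {i | i < n + 2} from hj) ⟨hadj, p, hp, hpz⟩
  have hcircle : IsCircle Z := by
    refine nonempty_homeomorph_circle_of_necklace (fun j => vertexPt G (a j)) L
      (congrArg _ hcyc) (fun j hj => (hL j hj).isArc) ?_ hT2
    rintro i j hij hj p ⟨hpi, hpj⟩
    have hi : i < n + 2 := by omega
    cases p with
    | atEnd ε =>
      obtain ⟨k, rfl, hk⟩ := (hL i hi).mem_of_atEnd ε hpi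
      obtain ⟨l, rfl, hl⟩ := (hL j hj).mem_of_atEnd ε hpj
      rw [hendinj k l (hk.symm.trans hl)] at hij
      omega
    | pt x hx =>
      obtain ⟨w, hw⟩ := complexPts_exists_pos hx
      have hmem : ∀ z, 0 < x z → (z = a j ∧ j = i + 1) ∨ (z = a 0 ∧ i = 0 ∧ j = n + 1) :=
        fun z hz => hWW i j hij hj z ((hL i hi).mem_of_coord_pos _ hpi z hz)
          ((hL j hj).mem_of_coord_pos _ hpj z hz)
      -- A common point of two links is supported in `A`; as no edge lies inside `A`, it is a
      -- vertex.
      have hmemA : ∀ z, 0 < x z → z ∈ A := by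
        intro z hz
        rcases hmem z hz with h | h
        · exact h.1 ▸ ha j hj
        · exact h.1 ▸ ha 0 (by omega)
      have hxw : EndCompl.pt x hx = vertexPt G w := by
        refine eq_vertexPt_of_forall_pos hx fun z hz => ?_
        by_contra hzw
        rcases hG.2.mem_of_adj (mem_innerPts_of_pos hx hzw hz hw).1 with h | h
        · exact hAB _ (hmemA w hw) h.2
        · exact hAB _ (hmemA z hz) h.1
      rw [hxw]
      rcases hmem w hw with ⟨rfl, h⟩ | ⟨rfl, h⟩
      exacts [Or.inl ⟨rfl, h⟩, Or.inr ⟨rfl, h⟩]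
  refine ⟨subgraphOf G Z, ⟨Z, hcircle, rfl⟩, fun v hv => ?_⟩
  have hverts : ∀ j < n + 2, W j ⊆ (subgraphOf G Z).verts := by
    intro j hj w hw
    obtain ⟨z, hz⟩ := (hL j hj).exists_edgeMeets w hw
    exact ⟨z, hz.mono (hLZ j hj)⟩
  have haverts : ∀ j < n + 2, a j ∈ (subgraphOf G Z).verts := fun j hj =>
    hverts j hj (hL j hj).left_mem
  rcases hcov hv with h | ⟨j, hj, rfl⟩
  · obtain ⟨i, hi⟩ := mem_iUnion.1 h
    rcases hcovW _ (hgap i) i rfl hi with h' | ⟨j, hj, rfl⟩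
    · exact hverts _ (hgap i) h'
    · exact haverts j hj
  · exact haverts j hj

/-! ### Finite cycles -/

/-- A finite cycle of a bipartite graph, listed along its two sides. -/
theorem exists_enumeration_of_isCycle {G : SimpleGraph V} {A B : Set V} (hG : IsBipartition G A B)
    {v : V} {c : G.Walk v v} (hc : c.IsCycle) (hv : v ∈ A) :
    ∃ (n : ℕ) (a b : ℕ → V), (∀ j < n + 2, a j ∈ A) ∧ (∀ j < n + 2, b j ∈ B) ∧
      a (n + 2) = a 0 ∧ (∀ j < n + 2, G.Adj (a j) (b j)) ∧
      (∀ j < n + 2, G.Adj (b j) (a (j + 1))) ∧ InjOn a (Iio (n + 2)) ∧ InjOn b (Iio (n + 2)) ∧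
      a '' Iio (n + 2) = {w | w ∈ c.support} ∩ A := by
  have hAB : ∀ v, v ∈ A → v ∈ B → False := fun v h₁ h₂ => Set.disjoint_left.1 hG.2.disjoint h₁ h₂
  have hpar : ∀ j, (2 * j ≤ c.length → c.getVert (2 * j) ∈ A) ∧
      (2 * j + 1 ≤ c.length → c.getVert (2 * j + 1) ∈ B) := by
    intro j
    have hodd : ∀ i, c.getVert i ∈ A → i + 1 ≤ c.length → c.getVert (i + 1) ∈ B := by
      intro i hi hlen
      rcases hG.2.mem_of_adj (c.adj_getVert_succ (by omega : i < c.length)) with h | h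
      · exact h.2
      · exact (hAB _ hi h.1).elim
    have heven : ∀ i, c.getVert i ∈ B → i + 1 ≤ c.length → c.getVert (i + 1) ∈ A := by
      intro i hi hlen
      rcases hG.2.mem_of_adj (c.adj_getVert_succ (by omega : i < c.length)) with h | h
      · exact (hAB _ h.1 hi).elim
      · exact h.2
    induction j with
    | zero =>
      have h0 : c.getVert (2 * 0) ∈ A := by simpa using hv
      exact ⟨fun _ => h0, hodd _ h0⟩
    | succ j ih =>
      have h1 : 2 * (j + 1) ≤ c.length → c.getVert (2 * (j + 1)) ∈ A := fun h =>
        heven _ (ih.2 (by omega)) h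
      exact ⟨h1, fun h => hodd _ (h1 (by omega)) h⟩
  have hlen := hc.three_le_length
  -- An odd closed walk would return to its start on the other side. An even length that is at least
  -- 3 is at least 4, whence `m = n + 2`.
  obtain ⟨m, hm⟩ : ∃ m, c.length = 2 * m := by
    rcases Nat.even_or_odd' c.length with ⟨m, hm | hm⟩
    · exact ⟨m, hm⟩
    · have h1 := (hpar m).2 hm.ge
      rw [← hm, c.getVert_length] at h1
      exact (hAB _ hv h1).elim
  obtain ⟨n, rfl⟩ : ∃ n, m = n + 2 := ⟨m - 2, by omega⟩
  have hinj : ∀ i j, i < c.length → j < c.length → c.getVert i = c.getVert j → i = j :=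
    fun i j hi hj h => hc.getVert_injOn' (by simp only [mem_ofPred_eq]; omega)
      (by simp only [mem_ofPred_eq]; omega) h
  refine ⟨n, fun j => c.getVert (2 * j), fun j => c.getVert (2 * j + 1),
    fun j hj => (hpar j).1 (by omega), fun j hj => (hpar j).2 (by omega), ?_,
    fun j hj => c.adj_getVert_succ (by omega), fun j hj => ?_, fun i hi j hj h => ?_,
    fun i hi j hj h => ?_, ?_⟩
  · simp only [← hm, c.getVert_length, mul_zero, c.getVert_zero]
  · exact c.adj_getVert_succ (by omega : 2 * j + 1 < c.length)
  · simp only [mem_Iio] at hi hj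
    have := hinj _ _ (by omega) (by omega) h
    omega
  · simp only [mem_Iio] at hi hj
    have := hinj _ _ (by omega) (by omega) h
    omega
  · ext w
    constructor
    · rintro ⟨j, hj, rfl⟩
      simp only [mem_Iio] at hj
      exact ⟨c.getVert_mem_support _, (hpar j).1 (by omega)⟩
    · rintro ⟨hw, hwA⟩
      obtain ⟨i, rfl, hi⟩ := SimpleGraph.Walk.mem_support_iff_exists_getVert.1 hw
      rcases Nat.even_or_odd' i with ⟨j, rfl | rfl⟩
      · rcases hi.lt_or_eq with h | h
        · exact ⟨j, by simp only [mem_Iio]; omega, rfl⟩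
        · refine ⟨0, by simp, ?_⟩
          simp only [h, c.getVert_length, mul_zero, c.getVert_zero]
      · exact (hAB _ hwA ((hpar j).2 hi)).elim

/-- Under Salia's conjecture for finite graphs, every finite subset of `A` is the trace on `A` of a
finite cycle of a possibly infinite dHp graph. -/
theorem SaliaConjectureFinite.exists_cycle (hS : SaliaConjectureFinite) {G : SimpleGraph V}
    {A B : Set V} (hG : IsDHP G A B) {X : Set V} (hX : X.Finite) (hXA : X ⊆ A)
    (hXn : X.Nontrivial) :
    ∃ (n : ℕ) (a b : ℕ → V), (∀ j < n + 2, a j ∈ A) ∧ (∀ j < n + 2, b j ∈ B) ∧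
      a (n + 2) = a 0 ∧ (∀ j < n + 2, G.Adj (a j) (b j)) ∧
      (∀ j < n + 2, G.Adj (b j) (a (j + 1))) ∧ InjOn a (Iio (n + 2)) ∧ InjOn b (Iio (n + 2)) ∧
      a '' Iio (n + 2) = X := by
  classical
  obtain ⟨hbip, -, hhall⟩ := hG
  have hAB : ∀ v, v ∈ A → v ∈ B → False := fun v h₁ h₂ =>
    Set.disjoint_left.1 hbip.2.disjoint h₁ h₂
  -- Each `Y` gets an injection witnessing the double Hall condition. Finitely many of these, for `Y
  -- ⊆ X`, suffice to cut out a finite subgraph that inherits the condition.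
  have hg : ∀ Y : Set V, ∃ g : V → V, Y ⊆ A → Y.Nontrivial → InjOn g Y ∧ MapsTo g Y (nbr2 G Y) := by
    intro Y
    by_cases h : Y ⊆ A ∧ Y.Nontrivial
    · obtain ⟨g⟩ := (Cardinal.le_def _ _).1 (hhall Y h.1 h.2)
      refine ⟨fun v => if hv : v ∈ Y then g ⟨v, hv⟩ else v, fun _ _ => ⟨?_, ?_⟩⟩
      · intro x hx y hy hxy
        simp only [dif_pos hx, dif_pos hy] at hxy
        exact congrArg Subtype.val (g.injective (Subtype.ext hxy))
      · intro x hx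
        simp only [dif_pos hx]
        exact (g ⟨x, hx⟩).2
    · exact ⟨id, fun h₁ h₂ => absurd ⟨h₁, h₂⟩ h⟩
  choose g hg using hg
  have hnbrB : ∀ Y ⊆ A, nbr2 G Y ⊆ B := by
    rintro Y hY v ⟨x, hx, -⟩
    rcases hbip.2.mem_of_adj hx.1 with h | h
    · exact (hAB _ (hY hx.2) h.2).elim
    · exact h.1
  let T : Set V := X ∪ ⋃ Y ∈ {Y : Set V | Y ⊆ X ∧ Y.Nontrivial}, g Y '' Y
  have hTfin : T.Finite := by
    refine hX.union (Set.Finite.biUnion (hX.finite_subsets.subset fun Y hY => hY.1) fun Y hY => ?_)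
    exact (hX.subset hY.1).image _
  have hTA : ∀ v ∈ T, v ∈ A → v ∈ X := by
    rintro v (hv | hv) hvA
    · exact hv
    · obtain ⟨Y, hY, y, hy, rfl⟩ := mem_iUnion₂.1 hv
      exact (hAB _ hvA (hnbrB Y (hY.1.trans hXA) ((hg Y (hY.1.trans hXA) hY.2).2 hy))).elim
  -- The conjecture speaks of vertex types in `Type`, so the subgraph on `T` is transported to `Fin
  -- N`.
  obtain ⟨N, f, hf, hfT⟩ := hTfin.fin_param
  let G' : SimpleGraph (Fin N) := G.comap f
  have hA' : f '' (f ⁻¹' A) = X := by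
    ext v
    constructor
    · rintro ⟨w, hw, rfl⟩
      exact hTA _ (hfT ▸ mem_range_self w) hw
    · intro hv
      obtain ⟨w, rfl⟩ : v ∈ range f := hfT ▸ Or.inl hv
      exact ⟨w, hXA hv, rfl⟩
  have hbip' : IsBipartition G' (f ⁻¹' A) (f ⁻¹' B) := by
    refine ⟨?_, hbip.2.disjoint.preimage f, fun v w hvw => hbip.2.mem_of_adj hvw⟩
    rw [← preimage_union, hbip.1, preimage_univ]
  have hhall' : DoubleHallCondition G' (f ⁻¹' A) := by
    intro Z hZA hZ
    have hZX : f '' Z ⊆ X := hA' ▸ image_mono hZA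
    have hZn : (f '' Z).Nontrivial := hZ.image hf
    obtain ⟨hinj, hmaps⟩ := hg (f '' Z) (hZX.trans hXA) hZn
    have hex : ∀ z : Z, ∃ w : nbr2 G' Z, f w = g (f '' Z) (f z) := by
      intro z
      have hz : f z ∈ f '' Z := mem_image_of_mem f z.2
      obtain ⟨w, hw⟩ : g (f '' Z) (f z) ∈ range f :=
        hfT ▸ Or.inr (mem_biUnion (show f '' Z ∈ {Y : Set V | Y ⊆ X ∧ Y.Nontrivial} from
          ⟨hZX, hZn⟩) (mem_image_of_mem _ hz))
      have hm := hmaps hz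
      rw [← hw] at hm
      obtain ⟨_, ⟨hx, x, hxZ, rfl⟩, _, ⟨hy, y, hyZ, rfl⟩, hxy⟩ := hm
      exact ⟨⟨w, x, ⟨hx, hxZ⟩, y, ⟨hy, hyZ⟩, fun h => hxy (h ▸ rfl)⟩, hw⟩
    choose k hk using hex
    refine Cardinal.mk_le_of_injective (f := k) fun z z' h => ?_
    have := hk z
    rw [h, hk z'] at this
    exact Subtype.ext (hf (hinj (mem_image_of_mem f z'.2) (mem_image_of_mem f z.2) this)).symm
  have hA'n : (f ⁻¹' A).Nontrivial := by
    rw [← hA'] at hXn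
    obtain ⟨_, ⟨x, hx, rfl⟩, _, ⟨y, hy, rfl⟩, hxy⟩ := hXn
    exact ⟨x, hx, y, hy, fun h => hxy (h ▸ rfl)⟩
  obtain ⟨v, c, hc, hcA⟩ := hS (Fin N) G' _ _ hbip' hhall' _ subset_rfl hA'n
  let φ : G' →g G := ⟨f, fun h => h⟩
  have hcA' : {w | w ∈ (c.map φ).support} ∩ A = X := by
    rw [← hA', ← hcA]
    ext w
    rw [SimpleGraph.Walk.support_map]
    constructor
    · rintro ⟨hw, hwA⟩
      obtain ⟨z, hz, rfl⟩ := List.mem_map.1 hw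
      exact ⟨z, ⟨hz, hwA⟩, rfl⟩
    · rintro ⟨z, ⟨hz, hzA⟩, rfl⟩
      exact ⟨List.mem_map.2 ⟨z, hz, rfl⟩, hzA⟩
  have hc' : (c.map φ).IsCycle := hc.map hf
  generalize c.map φ = d at hcA' hc'
  obtain ⟨u, hu⟩ := hXn.nonempty
  rw [← hcA'] at hu
  obtain ⟨n, a, b, h₁, h₂, h₃, h₄, h₅, h₆, h₇, h₈⟩ :=
    exists_enumeration_of_isCycle hbip (hc'.rotate hu.1) hu.2
  refine ⟨n, a, b, h₁, h₂, h₃, h₄, h₅, h₆, h₇, ?_⟩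
  rw [h₈, ← hcA']
  ext w
  have := congrArg SimpleGraph.Subgraph.verts (d.toSubgraph_rotate hu.1)
  have hiff : w ∈ (d.rotate u hu.1).support ↔ w ∈ d.support := by
    rw [← SimpleGraph.Walk.mem_verts_toSubgraph, this, SimpleGraph.Walk.mem_verts_toSubgraph]
  exact and_congr_left fun _ => hiff

/-! ### The graph of the vertices of degree two -/

/-- Two vertices are adjacent if they are the two neighbours of some vertex in `B`. -/
def linkGraph (G : SimpleGraph V) (B : Set V) : SimpleGraph V where
  Adj a b := a ≠ b ∧ ∃ v ∈ B, G.neighborSet v = {a, b}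
  symm := ⟨fun _ _ h => ⟨h.1.symm, h.2.imp fun _ hv => ⟨hv.1, hv.2.trans (pair_comm _ _)⟩⟩⟩
  loopless := ⟨fun _ h => h.1 rfl⟩

theorem linkGraph_adj_of_adj {G : SimpleGraph V} {B : Set V} {v a b : V} (hv : v ∈ B)
    (hdeg : (G.neighborSet v).encard = 2) (ha : G.Adj v a) (hb : G.Adj v b) (hab : a ≠ b) :
    (linkGraph G B).Adj a b := by
  refine ⟨hab, v, hv, ?_⟩
  obtain ⟨x, y, hxy, h⟩ := encard_eq_two.1 hdeg
  have ha' : a ∈ ({x, y} : Set V) := h ▸ ha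
  have hb' : b ∈ ({x, y} : Set V) := h ▸ hb
  rw [h]
  rcases ha' with rfl | rfl <;> rcases hb' with rfl | rfl
  exacts [absurd rfl hab, rfl, pair_comm _ _, absurd rfl hab]

theorem LinkedIn.inter_of_closed {G : SimpleGraph V} {P D : Set V} {a b : V} (h : LinkedIn G P a b)
    (hD : ∀ u ∈ D ∩ P, ∀ v ∈ P, G.Adj u v → v ∈ D) (ha : a ∈ D) : LinkedIn G (P ∩ D) a b := by
  classical
  obtain ⟨w, hw⟩ := h
  refine ⟨w, fun z hz => ⟨hw z hz, ?_⟩⟩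
  exact LinkedIn.closed
    ⟨w.takeUntil z hz, fun y hy => hw y (w.support_takeUntil_subset_support hz hy)⟩ hD ha

/-- A set that stays connected in the link graph after deleting finitely many vertices is robust
in `G`. -/
theorem isRobust_of_linkGraph {G : SimpleGraph V} {B C : Set V} (hC : C.Infinite)
    (h : ∀ F : Set V, F.Finite → ∀ a ∈ C \ F, ∀ b ∈ C \ F, LinkedIn (linkGraph G B) (C \ F) a b) :
    IsRobust G C (C ∪ {v ∈ B | G.neighborSet v ⊆ C}) := by
  intro F hF
  -- A link edge dies in `G` when its middle vertex is deleted. Deleting also the neighbours of the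
  -- deleted vertices of finite degree ensures that a link edge with an end outside `F'` keeps its
  -- middle vertex.
  let F' : Set V := F ∪ ⋃ v ∈ {v ∈ F | (G.neighborSet v).Finite}, G.neighborSet v
  have hF' : F'.Finite := hF.union ((hF.subset (sep_subset _ _)).biUnion fun v hv => hv.2)
  have hstep : ∀ a ∈ C \ F, ∀ c ∈ C \ F, (linkGraph G B).Adj a c → (a ∉ F' ∨ c ∉ F') →
      LinkedIn G ((C ∪ {v ∈ B | G.neighborSet v ⊆ C}) \ F) a c := by
    rintro a ha c hc ⟨-, v, hv, hN⟩ hac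
    have hva : G.Adj v a := by
      change a ∈ G.neighborSet v
      simp [hN]
    have hvc : G.Adj v c := by
      change c ∈ G.neighborSet v
      simp [hN]
    have hvF : v ∉ F := by
      intro hvF
      have hmem : v ∈ {v ∈ F | (G.neighborSet v).Finite} := ⟨hvF, hN ▸ toFinite _⟩
      rcases hac with h' | h'
      · exact h' (Or.inr (mem_biUnion hmem hva))
      · exact h' (Or.inr (mem_biUnion hmem hvc))
    have hvU : v ∈ (C ∪ {v ∈ B | G.neighborSet v ⊆ C}) \ F := by
      refine ⟨Or.inr ⟨hv, ?_⟩, hvF⟩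
      rw [hN]
      rintro x (rfl | rfl)
      exacts [ha.1, hc.1]
    exact LinkedIn.trans (LinkedIn.of_adj hva.symm ⟨Or.inl ha.1, ha.2⟩ hvU)
      (LinkedIn.of_adj hvc hvU ⟨Or.inl hc.1, hc.2⟩)
  have hlift : ∀ a b, LinkedIn (linkGraph G B) (C \ F') a b →
      LinkedIn G ((C ∪ {v ∈ B | G.neighborSet v ⊆ C}) \ F) a b := by
    rintro a b ⟨w, hw⟩
    induction w with
    | nil =>
      have := hw _ (SimpleGraph.Walk.start_mem_support _)
      exact LinkedIn.refl ⟨Or.inl this.1, fun h' => this.2 (Or.inl h')⟩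
    | cons hadj p ih =>
      have h₁ := hw _ (SimpleGraph.Walk.start_mem_support _)
      have h₂ : ∀ z ∈ p.support, z ∈ C \ F' := fun z hz => hw z (by simp [hz])
      have h₃ := h₂ _ p.start_mem_support
      exact (hstep _ ⟨h₁.1, fun h' => h₁.2 (Or.inl h')⟩ _ ⟨h₃.1, fun h' => h₃.2 (Or.inl h')⟩
        hadj (Or.inl h₁.2)).trans (ih h₂)
  -- A vertex of `F' \ F` must still get out of `F'`. Sparing only `a` itself, the first edge of a
  -- walk to a vertex beyond `F'` does this.
  have hnbr : ∀ a ∈ C \ F, ∃ c ∈ C \ F',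
      LinkedIn G ((C ∪ {v ∈ B | G.neighborSet v ⊆ C}) \ F) a c := by
    intro a ha
    obtain ⟨z, hz, hzF⟩ := hC.exists_notMem_finite (hF'.insert a)
    rw [mem_insert_iff, not_or] at hzF
    obtain ⟨w, hw⟩ := h (F' \ {a}) (hF'.subset sdiff_subset) a ⟨ha.1, fun h' => h'.2 rfl⟩ z
      ⟨hz, fun h' => hzF.2 h'.1⟩
    cases w with
    | nil => exact absurd rfl hzF.1
    | @cons _ c _ hadj p =>
      have hc : c ∈ C \ (F' \ {a}) := hw c (by simp)
      have hcF : c ∉ F' := fun h' => hc.2 ⟨h', hadj.ne.symm⟩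
      exact ⟨c, ⟨hc.1, hcF⟩, hstep a ha c ⟨hc.1, fun h' => hcF (Or.inl h')⟩ hadj (Or.inr hcF)⟩
  intro a ha b hb
  obtain ⟨c, hc, hac⟩ := hnbr a ha
  obtain ⟨d, hd, hbd⟩ := hnbr b hb
  exact (hac.trans (hlift c d (h F' hF' c hc d hd))).trans hbd.symm

/-- In a graph with bounded independent sets, deleting a suitable finite set of vertices leaves only
finitely many components, none of which can be disconnected by deleting finitely many vertices. -/
theorem exists_finite_robust_partition {M : SimpleGraph V} {A : Set V} {K : ℕ}
    (hK : ∀ I : Finset V, (I : Set V) ⊆ A → (∀ x ∈ I, ∀ y ∈ I, ¬ M.Adj x y) → I.card ≤ K) :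
    ∃ (F : Set V) (I : Finset V), F.Finite ∧ F ⊆ A ∧
      (∀ z ∈ A \ F, ∃ y ∈ I, LinkedIn M (A \ F) y z) ∧
      (∀ x ∈ I, ∀ y ∈ I, LinkedIn M (A \ F) x y → x = y) ∧
      ∀ y ∈ I, ∀ F' : Set V, F'.Finite → ∀ a ∈ {z | LinkedIn M (A \ F) y z} \ F',
        ∀ b ∈ {z | LinkedIn M (A \ F) y z} \ F',
          LinkedIn M ({z | LinkedIn M (A \ F) y z} \ F') a b := by
  classical
  -- `P m`: some finite deletion leaves `m` vertices in distinct components. Such vertices are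
  -- independent, so `m ≤ K` and a largest `m` exists.
  let P : ℕ → Prop := fun m => ∃ (F : Set V) (I : Finset V), F.Finite ∧ F ⊆ A ∧
    (I : Set V) ⊆ A \ F ∧ (∀ x ∈ I, ∀ y ∈ I, LinkedIn M (A \ F) x y → x = y) ∧ I.card = m
  have hPK : ∀ m, P m → m ≤ K := by
    rintro m ⟨F, I, -, -, hI, hind, rfl⟩
    refine hK I (hI.trans sdiff_subset) fun x hx y hy hxy => hxy.ne ?_
    exact hind x hx y hy (LinkedIn.of_adj hxy (hI hx) (hI hy))
  have hP0 : P 0 := ⟨∅, ∅, finite_empty, empty_subset _, by simp, by simp, rfl⟩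
  obtain ⟨F, I, hF, hFA, hI, hind, hcard⟩ := Nat.findGreatest_spec (Nat.zero_le K) hP0
  have hmax : ∀ m, P m → m ≤ I.card := fun m hm => hcard ▸ Nat.le_findGreatest (hPK m hm) hm
  refine ⟨F, I, hF, hFA, ?_, hind, ?_⟩
  · intro z hz
    by_contra hcon
    push Not at hcon
    replace hcon : ∀ y ∈ I, ¬ LinkedIn M (A \ F) z y := fun y hy h => hcon y hy h.symm
    have hzI : z ∉ I := fun h => hcon z h (LinkedIn.refl hz)
    have : P (insert z I).card := by
      refine ⟨F, insert z I, hF, hFA, ?_, ?_, rfl⟩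
      · rw [Finset.coe_insert]
        exact insert_subset hz hI
      · intro x hx y hy hxy
        rw [Finset.mem_insert] at hx hy
        rcases hx with rfl | hx <;> rcases hy with rfl | hy
        exacts [rfl, absurd hxy (hcon y hy), absurd hxy.symm (hcon x hx), hind x hx y hy hxy]
    have := hmax _ this
    rw [Finset.card_insert_of_notMem hzI] at this
    omega
  · intro y hy F' hF' a ha b hb
    by_contra hcon
    set Cy : Set V := {z | LinkedIn M (A \ F) y z} with hCy
    have hab : a ≠ b := by
      rintro rfl
      exact hcon (LinkedIn.refl ha)
    have hCyA : Cy ⊆ A \ F := fun z hz => LinkedIn.right_mem hz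
    have hother : ∀ x ∈ I.erase y, x ∉ Cy := fun x hx h =>
      (Finset.mem_erase.1 hx).1 (hind y hy x (Finset.mem_erase.1 hx).2 h).symm
    -- Only the part of `F'` inside the component of `y` is deleted, so the other representatives
    -- survive; replacing `y` by the separated `a` and `b` contradicts maximality.
    let F₂ : Set V := F ∪ (F' ∩ Cy)
    have hF₂ : A \ F₂ ⊆ A \ F := fun z hz => ⟨hz.1, fun h => hz.2 (Or.inl h)⟩
    let I₂ : Finset V := insert a (insert b (I.erase y))
    have hcard₂ : I₂.card = I.card + 1 := by
      have hbI : b ∉ I.erase y := fun h => hother b h hb.1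
      have haI : a ∉ insert b (I.erase y) := by
        rw [Finset.mem_insert, not_or]
        exact ⟨hab, fun h => hother a h ha.1⟩
      rw [Finset.card_insert_of_notMem haI, Finset.card_insert_of_notMem hbI,
        Finset.card_erase_add_one hy]
    have hcross : ∀ x ∈ I.erase y, ∀ z ∈ Cy, ¬ LinkedIn M (A \ F₂) x z := fun x hx z hz h =>
      hother x hx (LinkedIn.trans hz (h.symm.mono hF₂))
    have hablink : ¬ LinkedIn M (A \ F₂) a b := by
      intro h
      refine hcon ((h.inter_of_closed (D := Cy) ?_ ha.1).mono ?_)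
      · intro u hu v hv huv
        exact LinkedIn.trans hu.1 (LinkedIn.of_adj huv (hF₂ hu.2) (hF₂ hv))
      · exact fun z hz => ⟨hz.2, fun h => hz.1.2 (Or.inr ⟨h, hz.2⟩)⟩
    have hP : P I₂.card := by
      refine ⟨F₂, I₂, hF.union (hF'.subset inter_subset_left),
        union_subset hFA (inter_subset_right.trans (hCyA.trans sdiff_subset)), ?_, ?_, rfl⟩
      · intro x hx
        have hx' : x = a ∨ x = b ∨ x ∈ I.erase y := by
          simpa only [I₂, Finset.mem_coe, Finset.mem_insert] using hx
        rcases hx' with rfl | rfl | hx'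
        · exact ⟨(hCyA ha.1).1, fun h => h.elim (hCyA ha.1).2 fun h => ha.2 h.1⟩
        · exact ⟨(hCyA hb.1).1, fun h => h.elim (hCyA hb.1).2 fun h => hb.2 h.1⟩
        · have hxI := hI (Finset.mem_coe.2 (Finset.mem_of_mem_erase hx'))
          exact ⟨hxI.1, fun h => h.elim hxI.2 fun h => hother x hx' h.2⟩
      · intro x hx z hz hxz
        simp only [I₂, Finset.mem_insert] at hx hz
        rcases hx with rfl | rfl | hx <;> rcases hz with rfl | rfl | hz
        · rfl
        · exact absurd hxz hablink
        · exact absurd hxz.symm (hcross _ hz _ ha.1)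
        · exact absurd hxz.symm hablink
        · rfl
        · exact absurd hxz.symm (hcross _ hz _ hb.1)
        · exact absurd hxz (hcross _ hx _ ha.1)
        · exact absurd hxz (hcross _ hx _ hb.1)
        · exact hind x (Finset.mem_of_mem_erase hx) z (Finset.mem_of_mem_erase hz) (hxz.mono hF₂)
    have := hmax _ hP
    omega

/-- If finitely many vertices of `B` have neighbourhood `A`, all others having degree two, then
independent sets of the link graph are bounded. -/
theorem card_le_of_linkGraph_independent {G : SimpleGraph V} {A B : Set V} (hG : IsDHP G A B)
    (hdeg : ∀ v ∈ B, (G.neighborSet v).encard = 2 ∨ G.neighborSet v = A)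
    (hfull : {v ∈ B | G.neighborSet v = A}.Finite) {I : Finset V} (hIA : (I : Set V) ⊆ A)
    (hI : ∀ x ∈ I, ∀ y ∈ I, ¬ (linkGraph G B).Adj x y) :
    I.card ≤ {v ∈ B | G.neighborSet v = A}.ncard + 1 := by
  by_contra hcon
  push Not at hcon
  -- The `+ 1` in the bound serves sets with fewer than two elements, on which the double Hall
  -- condition is silent.
  have hIn : (I : Set V).Nontrivial := Finset.one_lt_card_iff_nontrivial.1 (by omega)
  have hsub : nbr2 G I ⊆ {v ∈ B | G.neighborSet v = A} := by
    rintro v ⟨x, hx, y, hy, hxy⟩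
    have hvB : v ∈ B := by
      rcases hG.1.2.mem_of_adj hx.1 with h | h
      · exact (Set.disjoint_left.1 hG.1.2.disjoint (hIA hx.2) h.2).elim
      · exact h.1
    refine ⟨hvB, (hdeg v hvB).resolve_left fun h => ?_⟩
    exact hI x hx.2 y hy.2 (linkGraph_adj_of_adj hvB h hx.1 hy.1 hxy)
  have hle := (hG.2.2 I hIA hIn).trans (Cardinal.mk_le_mk_of_subset hsub)
  have := hfull.to_subtype
  have h2 := Cardinal.toNat_le_toNat hle (Cardinal.mk_lt_aleph0)
  have h3 : I.card ≤ {v ∈ B | G.neighborSet v = A}.ncard := by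
    rw [← ncard_coe_finset]
    exact h2
  omega

/-! ### The two cases of the theorem -/

/-- Some full vertex survives every finite deletion and joins all remaining vertices of `A`. So `A`
is a single robust set, and any finite cycle through two of its vertices can be enlarged to absorb
it. -/
theorem exists_isTopCycle_of_infinite_full [Countable V] {G : SimpleGraph V} {A B : Set V}
    (hG : IsDHP G A B) (hA : A.Infinite) (hfull : {v ∈ B | G.neighborSet v = A}.Infinite)
    (hS : SaliaConjectureFinite) : ∃ H : G.Subgraph, IsTopCycle H ∧ A ⊆ H.verts := by
  obtain ⟨x, hx, y, hy, hxy⟩ := hA.nontrivial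
  obtain ⟨n, a, b, ha, hb, hcyc, hab, hba, hainj, hbinj, himg⟩ :=
    hS.exists_cycle hG (toFinite {x, y}) (pair_subset hx hy) (nontrivial_pair hxy)
  have hrob : IsRobust G A (A ∪ {v ∈ B | G.neighborSet v = A}) := by
    intro F hF z hz w hw
    obtain ⟨v, hv, hvF⟩ := hfull.exists_notMem_finite hF
    have hadj : ∀ u ∈ A, G.Adj v u := fun u hu => by
      change u ∈ G.neighborSet v
      rwa [hv.2]
    exact LinkedIn.trans (LinkedIn.of_adj (hadj z hz.1).symm ⟨Or.inl hz.1, hz.2⟩ ⟨Or.inr hv, hvF⟩)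
      (LinkedIn.of_adj (hadj w hw.1) ⟨Or.inr hv, hvF⟩ ⟨Or.inl hw.1, hw.2⟩)
  refine exists_isTopCycle_of_cycle hG.1 ha hb hcyc hab hba hainj hbinj (ι := Unit)
    (fun _ => A) (fun _ => A ∪ {v ∈ B | G.neighborSet v = A}) (fun _ => 0) (fun _ => by omega)
    (fun _ => hrob) (fun _ => subset_union_left) (fun _ => subset_rfl)
    (fun _ => inter_subset_right) (fun _ => hA) (fun i i' h => absurd rfl h)
    (fun _ => ha 0 (by omega)) (fun _ => ha 1 (by omega)) (fun i i' h => absurd rfl h) ?_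
  exact fun v hv => Or.inl (mem_iUnion.2 ⟨(), hv⟩)

theorem exists_isTopCycle_of_finite_full [Countable V] {G : SimpleGraph V} {A B : Set V}
    (hG : IsDHP G A B) (hA : A.Infinite)
    (hdeg : ∀ v ∈ B, (G.neighborSet v).encard = 2 ∨ G.neighborSet v = A)
    (hfull : {v ∈ B | G.neighborSet v = A}.Finite)
    (hS : SaliaConjectureFinite) : ∃ H : G.Subgraph, IsTopCycle H ∧ A ⊆ H.verts := by
  classical
  have hAB : ∀ v, v ∈ A → v ∈ B → False := fun v h₁ h₂ =>
    Set.disjoint_left.1 hG.1.2.disjoint h₁ h₂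
  have hadjB : ∀ {u v}, u ∈ A → G.Adj u v → v ∈ B := by
    intro u v hu huv
    rcases hG.1.2.mem_of_adj huv with h | h
    exacts [h.2, (hAB u hu h.1).elim]
  have hadjA : ∀ {u v}, u ∈ B → G.Adj u v → v ∈ A := by
    intro u v hu huv
    rcases hG.1.2.mem_of_adj huv with h | h
    exacts [(hAB u h.1 hu).elim, h.2]
  obtain ⟨F, I, hF, hFA, hcover, hind, hrob⟩ :=
    exists_finite_robust_partition (M := linkGraph G B) (A := A)
      fun I hI h => card_le_of_linkGraph_independent hG hdeg hfull hI h
  let comp : V → Set V := fun y => {z | LinkedIn (linkGraph G B) (A \ F) y z}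
  have hcompA : ∀ y, comp y ⊆ A \ F := fun y z hz => LinkedIn.right_mem hz
  have hcompadj : ∀ y, ∀ a ∈ comp y, ∀ c ∈ A \ F, (linkGraph G B).Adj a c → c ∈ comp y :=
    fun y a ha c hc h => LinkedIn.trans ha (LinkedIn.of_adj h (hcompA y ha) hc)
  have hcompdisj : ∀ y ∈ I, ∀ y' ∈ I, ∀ z, z ∈ comp y → z ∈ comp y' → y = y' :=
    fun y hy y' hy' z hz hz' => hind y hy y' hy' (LinkedIn.trans hz (LinkedIn.symm hz'))
  let ι : Type u := {y : V // y ∈ I ∧ (comp y).Infinite}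
  have hιfin : Finite ι := (I.finite_toSet.subset fun y (hy : y ∈ I ∧ _) => hy.1).to_subtype
  -- The part of `A` that the rays need not reach; it is put on the finite cycle.
  let S : Set V := F ∪ ⋃ y ∈ {y | y ∈ I ∧ (comp y).Finite}, comp y
  have hSfin : S.Finite := hF.union <|
    (I.finite_toSet.subset fun y (hy : y ∈ I ∧ _) => hy.1).biUnion fun y hy => hy.2
  have hSA : S ⊆ A := union_subset hFA (iUnion₂_subset fun y _ => (hcompA y).trans sdiff_subset)
  have hcoverS : ∀ z ∈ A, z ∉ S → ∃ i : ι, z ∈ comp i.1 := by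
    intro z hz hzS
    obtain ⟨y, hy, hyz⟩ := hcover z ⟨hz, fun h => hzS (Or.inl h)⟩
    refine ⟨⟨y, hy, fun hfin => hzS (Or.inr ?_)⟩, hyz⟩
    exact mem_biUnion (show y ∈ {y | y ∈ I ∧ (comp y).Finite} from ⟨hy, hfin⟩) hyz
  let full : Set V := {v ∈ B | G.neighborSet v = A}
  -- More vertices than there are ways out of the component; the 2 also makes each `K i` nontrivial.
  have hKex : ∀ i : ι, ∃ K : Finset V, (K : Set V) ⊆ comp i.1 ∧
      K.card = (full ∪ S).ncard + 2 := fun i =>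
    i.2.2.exists_subset_card_eq _
  choose K hKcomp hKcard using hKex
  let X : Set V := S ∪ ⋃ i, (K i : Set V)
  have hXfin : X.Finite := hSfin.union (finite_iUnion fun i => (K i).finite_toSet)
  have hXA : X ⊆ A := union_subset hSA
    (iUnion_subset fun i => (hKcomp i).trans ((hcompA _).trans sdiff_subset))
  have hXn : X.Nontrivial := by
    obtain ⟨z, hz, hzS⟩ := hA.exists_notMem_finite hSfin
    obtain ⟨i, -⟩ := hcoverS z hz hzS
    have : (K i : Set V).Nontrivial :=
      Finset.one_lt_card_iff_nontrivial.1 (by rw [hKcard]; omega)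
    exact this.mono ((subset_iUnion (fun i => (K i : Set V)) i).trans subset_union_right)
  obtain ⟨n, a, b, ha, hb, hcyc, hab, hba, hainj, hbinj, himg⟩ := hS.exists_cycle hG hXfin hXA hXn
  have ha' : ∀ j ≤ n + 2, a j ∈ A := by
    intro j hj
    rcases hj.lt_or_eq with h | rfl
    · exact ha j h
    · exact hcyc ▸ ha 0 (by omega)
  have hainj' : ∀ i < n + 2, ∀ j < n + 2, a (i + 1) = a (j + 1) → i = j := by
    intro i hi j hj h
    rcases (Nat.succ_le_of_lt hi).lt_or_eq with h₁ | h₁ <;>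
      rcases (Nat.succ_le_of_lt hj).lt_or_eq with h₂ | h₂
    · have := hainj h₁ h₂ h; omega
    · rw [show j + 1 = n + 2 from h₂, hcyc] at h
      have := hainj h₁ (show 0 < n + 2 by omega) h; omega
    · rw [show i + 1 = n + 2 from h₁, hcyc] at h
      have := hainj (show 0 < n + 2 by omega) h₂ h; omega
    · omega
  -- Otherwise the cycle leaves the component right after each vertex `a j` of `K i`. If `b j` is
  -- not full, it has degree two and links `a j` to `a (j + 1)`, which must then lie in `S`. Sending
  -- `a j` to `b j` or `a (j + 1)` accordingly injects `K i` into `full ∪ S`, which is too small.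
  have hgap : ∀ i : ι, ∃ j < n + 2, a j ∈ comp i.1 ∧ a (j + 1) ∈ comp i.1 := by
    intro i
    by_contra hcon
    push Not at hcon
    have hidx : ∀ x, ∃ j, x ∈ K i → j < n + 2 ∧ a j = x := by
      intro x
      by_cases hx : x ∈ K i
      · obtain ⟨j, hj, rfl⟩ : x ∈ a '' Iio (n + 2) := himg ▸ Or.inr (mem_iUnion.2 ⟨i, hx⟩)
        exact ⟨j, fun _ => ⟨hj, rfl⟩⟩
      · exact ⟨0, fun h => absurd h hx⟩
    choose idx hidx using hidx
    have hUfin : (full ∪ S).Finite := Set.Finite.union hfull hSfin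
    have hle : (K i).card ≤ hUfin.toFinset.card := by
      refine Finset.card_le_card_of_injOn
        (fun x => if b (idx x) ∈ full then b (idx x) else a (idx x + 1)) ?_ ?_
      · intro x hx
        obtain ⟨hj, hjx⟩ := hidx x hx
        have hxC : a (idx x) ∈ comp i.1 := by
          rw [hjx]
          exact hKcomp i hx
        have hnot := hcon _ hj hxC
        rw [Finset.mem_coe, hUfin.mem_toFinset]
        dsimp only
        split_ifs with h
        · exact Or.inl h
        · refine Or.inr ?_
          by_contra hS'
          refine hnot (hcompadj _ _ hxC _ ⟨ha' _ hj, fun h' => hS' (Or.inl h')⟩ ?_)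
          refine linkGraph_adj_of_adj (hb _ hj) ?_ (hab _ hj).symm (hba _ hj) ?_
          · exact (hdeg _ (hb _ hj)).resolve_right fun h' => h ⟨hb _ hj, h'⟩
          · intro h'
            exact hnot (h' ▸ hxC)
      · intro x hx y hy hxy
        obtain ⟨hj, hjx⟩ := hidx x hx
        obtain ⟨hk, hky⟩ := hidx y hy
        have hjk : idx x = idx y := by
          dsimp only at hxy
          split_ifs at hxy with h₁ h₂ h₂
          · exact hbinj hj hk hxy
          · exact (hAB _ (ha' _ hk) (hxy ▸ hb _ hj)).elim
          · exact (hAB _ (ha' _ hj) (hxy ▸ hb _ hk)).elim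
          · exact hainj' _ hj _ hk hxy
        rw [← hjx, ← hky, hjk]
    rw [hKcard, ← ncard_eq_toFinset_card _ hUfin] at hle
    omega
  choose gap hgaplt hgap₁ hgap₂ using hgap
  have hnonempty : ∀ v ∈ B, (G.neighborSet v).Nonempty := by
    intro v hv
    rcases hdeg v hv with h | h
    · rw [← encard_ne_zero, h]
      exact two_ne_zero
    · rw [h]
      exact hA.nonempty
  have hne : ∀ i i' : ι, i ≠ i' → ∀ z, z ∈ comp i.1 → z ∉ comp i'.1 := fun i i' h z hz hz' =>
    h (Subtype.ext (hcompdisj _ i.2.1 _ i'.2.1 z hz hz'))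
  refine exists_isTopCycle_of_cycle hG.1 ha hb hcyc hab hba hainj hbinj (fun i : ι => comp i.1)
    (fun i => comp i.1 ∪ {v ∈ B | G.neighborSet v ⊆ comp i.1}) gap hgaplt
    (fun i => isRobust_of_linkGraph i.2.2 (hrob _ i.2.1)) (fun _ => subset_union_left)
    (fun i => (hcompA _).trans sdiff_subset) ?_ (fun i => i.2.2) ?_ hgap₁ hgap₂ ?_ ?_
  · rintro i v ⟨hv | hv, hvA⟩
    exacts [hv, (hAB v hvA hv.1).elim]
  · intro i i' hii
    rw [Set.disjoint_left]
    rintro v (hv | hv) (hv' | hv')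
    · exact hne i i' hii v hv hv'
    · exact hAB v (hcompA _ hv).1 hv'.1
    · exact hAB v (hcompA _ hv').1 hv.1
    · obtain ⟨z, hz⟩ := hnonempty v hv.1
      exact hne i i' hii z (hv.2 hz) (hv'.2 hz)
  · intro i i' hii
    -- Once `F` and the full vertices are deleted, every 2-path between distinct vertices of `A` is
    -- a link edge, so a component together with its neighbours in `B` cannot be left.
    refine ⟨F ∪ full, comp i.1 ∪ {v ∈ B | ∃ z ∈ comp i.1, G.Adj v z}, hF.union hfull, ?_, ?_, ?_⟩
    · rintro v (hv | hv)
      · exact Or.inl hv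
      · obtain ⟨z, hz⟩ := hnonempty v hv.1
        exact Or.inr ⟨hv.1, z, hv.2 hz, hz⟩
    · rw [Set.disjoint_left]
      rintro v (hv | ⟨hvB, z, hz, hvz⟩) (hv' | hv')
      · exact hne i i' hii v hv hv'
      · exact hAB v (hcompA _ hv).1 hv'.1
      · exact hAB v (hcompA _ hv').1 hvB
      · exact hne i i' hii z hz (hv'.2 hvz)
    · rintro u (hu | ⟨huB, z, hz, huz⟩) huF v hvF huv
      · exact Or.inr ⟨hadjB (hcompA _ hu).1 huv, u, hu, huv.symm⟩
      · left
        by_cases hzv : z = v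
        · exact hzv ▸ hz
        · refine hcompadj _ z hz v ⟨hadjA huB huv, fun h => hvF (Or.inl h)⟩ ?_
          refine linkGraph_adj_of_adj huB ?_ huz huv hzv
          exact (hdeg u huB).resolve_right fun h => huF (Or.inr ⟨huB, h⟩)
  · intro v hv
    by_cases hvS : v ∈ S
    · exact Or.inr (himg ▸ Or.inl hvS)
    · obtain ⟨i, hi⟩ := hcoverS v hv hvS
      exact Or.inl (mem_iUnion.2 ⟨i, hi⟩)

end DHall

theorem theorem3p6 {V : Type*} [Countable V] (G : SimpleGraph V) (A B : Set V)
    (hG : DHall.IsDHP G A B) (hA : A.Infinite) (hB : B.Infinite)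
    (hdeg : ∀ v ∈ B, (G.neighborSet v).encard = 2 ∨ G.neighborSet v = A)
    (hSalia : DHall.SaliaConjectureFinite) :
    ∃ H : G.Subgraph, DHall.IsTopCycle H ∧ A ⊆ H.verts := by
  by_cases hfull : {v ∈ B | G.neighborSet v = A}.Finite
  · exact DHall.exists_isTopCycle_of_finite_full hG hA hdeg hfull hSalia
  · exact DHall.exists_isTopCycle_of_infinite_full hG hA hfull hSalia
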